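/- Let $m\ge 1$. Write $z=(z_1,z_2)\in\mathbb{R}\times\mathbb{R}^{m-1}=\mathbb{R}^m$, $\hat z:=(z_1,-z_2)$, let $\|\cdot\|$ be the Euclidean norm and $\langle\cdot,\cdot\rangle$ the Euclidean inner product, and let $$\mathcal K=\{z\in\mathbb{R}^m : z_1\ge\|z_2\|\},\qquad \Omega=\{(x,y)\in\mathbb{R}^m\times\mathbb{R}^m : x\in\mathcal K,\ y\in\mathcal K,\ \langle x,y\rangle=0\}.$$ For $C\subseteq\mathbb{R}^n$, $z\in C$, $d\in\mathbb{R}^n$ (where $t_k\downarrow0$ means $t_k>0$, $t_k\to0$) define: * the tangent cone $T_C(z)=\{u : \exists\,t_k\downarrow0,\ u_k\to u \text{ with } z+t_ku_k\in C\ \forall k\}$ and the inner tangent cone $T^i_C(z)=\{u : \forall\,t_k\downarrow0\ \exists\,u_k\to u \text{ with } z+t_ku_k\in C\ \forall k\}$; * the regular normal cone $\widehat N_C(z)=\{v : \langle v,z'-z\rangle\le o(\|z'-z\|)\ \text{for } z'\in C\}$, with $\widehat N_C(z)=\emptyset$ if $z\notin C$; * the limiting normal cone $N_C(z)=\{v :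 \exists\, z_k\to z,\ z_k\in C,\ v_k\to v,\ v_k\in\widehat N_C(z_k)\ \forall k\}$; * the directional normal cone $N_C(z;d)=\{v : \exists\,t_k\downarrow0,\ d_k\to d,\ v_k\to v \text{ with } v_k\in\widehat N_C(z+t_kd_k)\ \forall k\}$; * the inner directional normal cone $N^i_C(z;d)=\{v : \forall\,t_k\downarrow0\ \exists\,d_k\to d,\ v_k\to v \text{ with } v_k\in\widehat N_C(z+t_kd_k)\ \forall k\}$. **Theorem.** The set $\Omega$ is directionally regular, i.e. $N_\Omega(z;\delta)=N^i_\Omega(z;\delta)$ for every $z\in\Omega$ and every $\delta\in\mathbb{R}^m\times\mathbb{R}^m$. For every $(x,y)\in\Omega$ one has $T_\Omega(x,y)=T^i_\Omega(x,y)$, and for every $(d,w)\in T_\Omega(x,y)$ the directional normal cone is given as follows. 1. If $x=0$, $y\in\operatorname{int}\mathcal K$: $N_\Omega((x,y);(d,w))=N_\Omega(x,y)=\mathbb{R}^m\times\{0\}$. 2. If $x\in\operatorname{int}\mathcal K$, $y=0$: $N_\Omega((x,y);(d,w))=N_\Omega(x,y)=\{0\}\times\mathbb{R}^m$. 3. If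 $x,y\in\operatorname{bd}\mathcal K\setminus\{0\}$: $N_\Omega((x,y);(d,w))=N_\Omega(x,y)$. 4. If $x\in\operatorname{bd}\mathcal K\setminus\{0\}$, $y=0$: $$N_\Omega((x,y);(d,w))=\begin{cases}\{0\}\times\mathbb{R}^m & \text{if } d\in\operatorname{int}T_{\mathcal K}(x),\ w=0,\\ N_\Omega(x,y) & \text{if } d\in\operatorname{bd}T_{\mathcal K}(x),\ w=0,\\ \{(u,v): u\in\mathbb{R}\hat x,\ v\perp\hat x\} & \text{if } d\perp\hat x,\ w\in\mathbb{R}_+\hat x\setminus\{0\}.\end{cases}$$ 5. If $x=0$, $y\in\operatorname{bd}\mathcal K\setminus\{0\}$: $$N_\Omega((x,y);(d,w))=\begin{cases}\mathbb{R}^m\times\{0\} & \text{if } d=0,\ w\in\operatorname{int}T_{\mathcal K}(y),\\ N_\Omega(x,y) & \text{if } d=0,\ w\in\operatorname{bd}T_{\mathcal K}(y),\\ \{(u,v): u\perp\hat y,\ v\in\mathbb{R}\hat y\} & \text{if } d\in\mathbb{R}_+\hat y\setminus\{0\},\ w\perp\hat y.\end{cases}$$ 6. If $x=y=0$: $N_\Omega((x,y);(d,w))=N_\Omega(d,w)$.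 Here the tangent cone $T_\Omega(x,y)$ is, in the six cases respectively, 1. $\{(d,w): d=0\}$; 2. $\{(d,w): w=0\}$; 3. $\{(d,w): x_1\hat w-y_1d\in\mathbb{R}x,\ d\perp y,\ w\perp x\}$; 4. $\{(d,w): d\in T_{\mathcal K}(x),\ w=0,\ \text{or } d\perp\hat x,\ w\in\mathbb{R}_+\hat x\}$; 5. $\{(d,w): d=0,\ w\in T_{\mathcal K}(y),\ \text{or } d\in\mathbb{R}_+\hat y,\ w\perp\hat y\}$; 6. $\Omega$; and the limiting normal cone $N_\Omega(x,y)$ is, besides the formulas in cases 1 and 2 above, 3. $\{(u,v): u\perp x,\ v\perp y,\ x_1\hat u+y_1v\in\mathbb{R}x\}$; 4. $\{(u,v): u=0,\ \text{or } u\in\mathbb{R}\hat x,\ v\perp\hat x,\ \text{or } u\in\mathbb{R}_-\hat x,\ \langle v,\hat x\rangle\le0\}$; 5. $\{(u,v): v=0,\ \text{or } u\perp\hat y,\ v\in\mathbb{R}\hat y,\ \text{or } \langle u,\hat y\rangle\le0,\ v\in\mathbb{R}_-\hat y\}$; 6. the set of all $(u,v)$ such that $u\in-\mathcal K,\ v\in-\mathcal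 K$; or $v=0$; or $u=0$; or, for some $\xi\in\{(1,\omega):\omega\in\mathbb{R}^{m-1},\ \|\omega\|=1\}$, one of the following holds: $u\in\mathbb{R}_-\xi$ and $\langle v,\xi\rangle\le0$; $\langle u,\xi\rangle\le0$ and $v\in\mathbb{R}_-\xi$; or $u\perp\xi$, $v\perp\hat\xi$ and $\alpha\hat u+(1-\alpha)v\in\mathbb{R}\xi$ for some $\alpha\in[0,1]$. -/

import Mathlib

open Filter Topology

noncomputable section

/-! Variational geometry of a set in a real inner product space.
In all sequences below, `t k ↓ 0` means that `t k > 0` for every `k` and `t k → 0`. -/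

section VariationalGeometry

variable {H : Type*} [NormedAddCommGroup H] [InnerProductSpace ℝ H]

/-- The tangent (Bouligand) cone `T_C(z)`. -/
def bouligandTangentCone (C : Set H) (z : H) : Set H :=
  {u | ∃ (t : ℕ → ℝ) (u' : ℕ → H), (∀ k, 0 < t k) ∧ Tendsto t atTop (𝓝 0) ∧
    Tendsto u' atTop (𝓝 u) ∧ ∀ k, z + t k • u' k ∈ C}

/-- The inner tangent (derivable) cone `T^i_C(z)`. -/
def innerTangentCone (C : Set H) (z : H) : Set H :=
  {u | ∀ t : ℕ → ℝ, (∀ k, 0 < t k) → Tendsto t atTop (𝓝 0) →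
    ∃ u' : ℕ → H, Tendsto u' atTop (𝓝 u) ∧ ∀ k, z + t k • u' k ∈ C}

/-- The regular (Fréchet) normal cone: those `v` with `⟨v, z' - z⟩ ≤ o(‖z' - z‖)` for `z' ∈ C`,
`z' → z`. It is empty at points outside `C`. -/
def regularNormalCone (C : Set H) (z : H) : Set H :=
  {v | z ∈ C ∧ ∀ ε : ℝ, 0 < ε → ∀ᶠ z' in 𝓝[C] z, inner ℝ v (z' - z) ≤ ε * ‖z' - z‖}

/-- The limiting (Mordukhovich) normal cone `N_C(z)`. -/
def limitingNormalCone (C : Set H) (z : H) : Set H :=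
  {v | ∃ z' v' : ℕ → H, (∀ k, z' k ∈ C) ∧ Tendsto z' atTop (𝓝 z) ∧
    Tendsto v' atTop (𝓝 v) ∧ ∀ k, v' k ∈ regularNormalCone C (z' k)}

/-- The limiting normal cone `N_C(z; d)` in direction `d`. -/
def directionalNormalCone (C : Set H) (z d : H) : Set H :=
  {v | ∃ (t : ℕ → ℝ) (d' v' : ℕ → H), (∀ k, 0 < t k) ∧ Tendsto t atTop (𝓝 0) ∧
    Tendsto d' atTop (𝓝 d) ∧ Tendsto v' atTop (𝓝 v) ∧
    ∀ k, v' k ∈ regularNormalCone C (z + t k • d' k)}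

/-- The inner limiting normal cone `N^i_C(z; d)` in direction `d`. -/
def innerDirectionalNormalCone (C : Set H) (z d : H) : Set H :=
  {v | ∀ t : ℕ → ℝ, (∀ k, 0 < t k) → Tendsto t atTop (𝓝 0) →
    ∃ d' v' : ℕ → H, Tendsto d' atTop (𝓝 d) ∧ Tendsto v' atTop (𝓝 v) ∧
      ∀ k, v' k ∈ regularNormalCone C (z + t k • d' k)}

/-- `C` is directionally regular: `N_C(z; d) = N^i_C(z; d)` at every point `z ∈ C` and in every
direction `d`. -/
def DirectionallyRegular (C : Set H) : Prop :=
  ∀ z ∈ C, ∀ d : H, directionalNormalCone C z d = innerDirectionalNormalCone C z d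

end VariationalGeometry

/-- `ℝ^m = ℝ × ℝ^{m-1}` (for `m ≥ 1`) with the Euclidean inner product; a vector is written
`x = (x₁, x₂)` with `x₁ = x.fst` and `x₂ = x.snd`. -/
abbrev SOCSpace (m : ℕ) : Type := WithLp 2 (ℝ × EuclideanSpace ℝ (Fin (m - 1)))

/-- The reflection `x̂ = (x₁, -x₂)`. -/
def SOCSpace.hat {m : ℕ} (x : SOCSpace m) : SOCSpace m := WithLp.toLp 2 (x.fst, -x.snd)

/-- The pair `(x, y)` as an element of `ℝ^m × ℝ^m` with the Euclidean inner product. -/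
def socPair {m : ℕ} (x y : SOCSpace m) : WithLp 2 (SOCSpace m × SOCSpace m) :=
  WithLp.toLp 2 (x, y)

/-- The `m`-dimensional second-order cone `K = {(x₁, x₂) | x₁ ≥ ‖x₂‖}`. -/
def secondOrderCone (m : ℕ) : Set (SOCSpace m) := {x | ‖x.snd‖ ≤ x.fst}

/-- The second-order cone complementarity set `Ω = {(x, y) | K ∋ x ⊥ y ∈ K}`. -/
def socComplementaritySet (m : ℕ) : Set (WithLp 2 (SOCSpace m × SOCSpace m)) :=
  {p | p.fst ∈ secondOrderCone m ∧ p.snd ∈ secondOrderCone m ∧ inner ℝ p.fst p.snd = 0}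

/-- The set `{(1, w) | ‖w‖ = 1}` of normalized nonzero boundary vectors of `K`. -/
def socBoundaryBase (m : ℕ) : Set (SOCSpace m) := {ξ | ξ.fst = 1 ∧ ‖ξ.snd‖ = 1}

end

/-! ### Tangents and normals of a general set -/

section VariationalLemmas

variable {H : Type*} [NormedAddCommGroup H] [InnerProductSpace ℝ H]

/-! Equality in Cauchy–Schwarz forces `y₁ x = x₁ ŷ` for `(x, y) ∈ Ω` (`fst_smul_eq_of_mem`). So, up
to exchanging the components, a point of `Ω` is `(x, 0)` with `x` interior, `(x, 0)` with `x ≠ 0` on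
the boundary, `(x, c x̂)` with `c > 0` and `x` on the boundary, or the origin.

Upper bounds for the tangent cones come from differentiating this identity, and `⟨x, x̂⟩ = 0` where
`y ≠ 0`, along sequences. Explicit curves (`socCurve`, `socPairCurve`) attain every direction that
is left; a curve serves all sequences `t k ↓ 0` at once, so these directions are inner tangents.
Regular normals follow by polarity (`mem_regularNormalCone_iff`).

The inner directional cone lies in the directional cone, which lies in the limiting cone. Upper
bounds: the regular normals on each stratum satisfy a closed relation, which survives limits; in the
directional version only the strata that the direction enters contribute. Lower bounds: a curve with
the prescribed velocity, carrying convergent regular normals, yields an inner directional normal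
(`mem_innerDirectionalNormalCone_of_curve`). The two bounds agree, which gives the formulas and
directional regularity together.

At the origin `Ω` is a closed cone whose regular normals are constant along open rays, so the
directional cone in direction `δ` is the limiting cone at `δ`. The limiting cone at the origin
itself collects the regular normals of all strata, in a set that is closed because its parameters
`ξ`, `α` range over compact sets. -/

lemma exists_pos_seq_tendsto_zero :
    ∃ t : ℕ → ℝ, (∀ k, 0 < t k) ∧ Tendsto t atTop (𝓝 0) :=
  ⟨fun k => 1 / ((k : ℝ) + 1), fun _ => by positivity, tendsto_one_div_add_atTop_nhds_zero_nat⟩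

lemma tendsto_nhdsGT_zero {t : ℕ → ℝ} (ht : ∀ k, 0 < t k) (h : Tendsto t atTop (𝓝 0)) :
    Tendsto t atTop (𝓝[>] 0) :=
  tendsto_nhdsWithin_iff.2 ⟨h, Eventually.of_forall ht⟩

lemma tendsto_add_smul {t : ℕ → ℝ} {u' : ℕ → H} {u z : H} (ht : Tendsto t atTop (𝓝 0))
    (hu : Tendsto u' atTop (𝓝 u)) : Tendsto (fun k => z + t k • u' k) atTop (𝓝 z) := by
  simpa using tendsto_const_nhds.add (ht.smul hu)

lemma innerTangentCone_subset (C : Set H) (z : H) :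
    innerTangentCone C z ⊆ bouligandTangentCone C z := by
  intro u hu
  obtain ⟨t, ht, ht0⟩ := exists_pos_seq_tendsto_zero
  obtain ⟨u', h1, h2⟩ := hu t ht ht0
  exact ⟨t, u', ht, ht0, h1, h2⟩

lemma innerDirectionalNormalCone_subset (C : Set H) (z d : H) :
    innerDirectionalNormalCone C z d ⊆ directionalNormalCone C z d := by
  intro v hv
  obtain ⟨t, ht, ht0⟩ := exists_pos_seq_tendsto_zero
  obtain ⟨d', v', h1, h2, h3⟩ := hv t ht ht0
  exact ⟨t, d', v', ht, ht0, h1, h2, h3⟩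

lemma directionalNormalCone_subset_limiting (C : Set H) (z d : H) :
    directionalNormalCone C z d ⊆ limitingNormalCone C z := by
  rintro v ⟨t, d', v', ht, ht0, h1, h2, h3⟩
  exact ⟨fun k => z + t k • d' k, v', fun k => (h3 k).1, tendsto_add_smul ht0 h1, h2, h3⟩

/-- Regular normals exist only at points of `C`. Hence both directional cones are empty in
non-tangent directions, and directional regularity need only be checked in tangent ones. -/
lemma mem_bouligandTangentCone_of_mem_directionalNormalCone {C : Set H} {z d v : H}
    (hv : v ∈ directionalNormalCone C z d) : d ∈ bouligandTangentCone C z := by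
  obtain ⟨t, d', v', ht, ht0, h1, h2, h3⟩ := hv
  exact ⟨t, d', ht, ht0, h1, fun k => (h3 k).1⟩

lemma zero_mem_regularNormalCone {C : Set H} {z : H} (hz : z ∈ C) :
    (0 : H) ∈ regularNormalCone C z := by
  refine ⟨hz, fun ε hε => Eventually.of_forall fun z' => ?_⟩
  rw [inner_zero_left]; positivity

lemma regularNormalCone_subset_limiting (C : Set H) (z : H) :
    regularNormalCone C z ⊆ limitingNormalCone C z := fun v hv =>
  ⟨fun _ => z, fun _ => v, fun _ => hv.1, tendsto_const_nhds, tendsto_const_nhds, fun _ => hv⟩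

lemma HasDerivAt.tendsto_inv_smul_sub_right {γ : ℝ → H} {u : H} (hγ : HasDerivAt γ u 0) :
    Tendsto (fun t : ℝ => t⁻¹ • (γ t - γ 0)) (𝓝[>] 0) (𝓝 u) := by
  have := (hasDerivAt_iff_tendsto_slope_zero.1 hγ).mono_left
    (nhdsWithin_mono (0 : ℝ) (fun t (ht : t ∈ Set.Ioi (0 : ℝ)) => (Set.mem_Ioi.1 ht).ne'))
  simpa using this

/-- The velocity of a curve in `C` is a derivable tangent direction. -/
lemma mem_innerTangentCone_of_curve {C : Set H} {z u : H} (hz : z ∈ C) {γ : ℝ → H}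
    (hγ : Tendsto (fun t : ℝ => t⁻¹ • (γ t - γ 0)) (𝓝[>] 0) (𝓝 u)) (h0 : γ 0 = z)
    (hC : ∀ᶠ t in 𝓝[>] (0 : ℝ), γ t ∈ C) :
    u ∈ innerTangentCone C z := by
  classical
  intro t ht ht0
  have hlim := tendsto_nhdsGT_zero ht ht0
  -- The curve is in `C` only for small `t`, but membership is required for every `k`; the default
  -- `0` keeps the point at `z`.
  refine ⟨fun k => if γ (t k) ∈ C then (t k)⁻¹ • (γ (t k) - γ 0) else 0, ?_, fun k => ?_⟩
  · refine (hγ.comp hlim).congr' ?_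
    filter_upwards [hlim.eventually hC] with k hk
    simp [hk]
  · by_cases hk : γ (t k) ∈ C
    · simp [hk, smul_smul, mul_inv_cancel₀ (ht k).ne', ← h0]
    · simp [hk, hz]

/-- A limit of regular normals along a curve is an inner directional normal in the direction of
the velocity of the curve. -/
lemma mem_innerDirectionalNormalCone_of_curve {C : Set H} {z u v : H} (hz : z ∈ C) {γ n : ℝ → H}
    (hγ : Tendsto (fun t : ℝ => t⁻¹ • (γ t - γ 0)) (𝓝[>] 0) (𝓝 u)) (h0 : γ 0 = z)
    (hn : Tendsto n (𝓝[>] 0) (𝓝 v))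
    (hC : ∀ᶠ t in 𝓝[>] (0 : ℝ), n t ∈ regularNormalCone C (γ t)) :
    v ∈ innerDirectionalNormalCone C z u := by
  classical
  intro t ht ht0
  have hlim := tendsto_nhdsGT_zero ht ht0
  -- Same default for the finitely many bad indices: the point `z` with the normal `0`.
  refine ⟨fun k => if n (t k) ∈ regularNormalCone C (γ (t k)) then
      (t k)⁻¹ • (γ (t k) - γ 0) else 0,
    fun k => if n (t k) ∈ regularNormalCone C (γ (t k)) then n (t k) else 0, ?_, ?_, fun k => ?_⟩
  · refine (hγ.comp hlim).congr' ?_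
    filter_upwards [hlim.eventually hC] with k hk
    simp [hk]
  · refine (hn.comp hlim).congr' ?_
    filter_upwards [hlim.eventually hC] with k hk
    simp [hk]
  · by_cases hk : n (t k) ∈ regularNormalCone C (γ (t k))
    · simp [hk, smul_smul, mul_inv_cancel₀ (ht k).ne', ← h0]
    · simp [hk, zero_mem_regularNormalCone hz]

lemma inner_nonpos_of_mem_regularNormalCone {C : Set H} {z u v : H}
    (hv : v ∈ regularNormalCone C z) (hu : u ∈ bouligandTangentCone C z) :
    inner ℝ v u ≤ 0 := by
  obtain ⟨t, u', ht, ht0, hu', hC⟩ := hu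
  have hz : Tendsto (fun k => z + t k • u' k) atTop (𝓝[C] z) :=
    tendsto_nhdsWithin_iff.2 ⟨tendsto_add_smul ht0 hu', Eventually.of_forall hC⟩
  have key : ∀ ε : ℝ, 0 < ε → inner ℝ v u ≤ ε * ‖u‖ := fun ε hε => by
    refine le_of_tendsto_of_tendsto (tendsto_const_nhds.inner hu') (hu'.norm.const_mul ε) ?_
    filter_upwards [hz.eventually (hv.2 ε hε)] with k hk
    rw [add_sub_cancel_left, inner_smul_right, norm_smul, Real.norm_of_nonneg (ht k).le] at hk
    exact le_of_mul_le_mul_left (by linarith) (ht k)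
  have hlim : Tendsto (fun ε : ℝ => ε * ‖u‖) (𝓝[>] 0) (𝓝 0) := by
    have : Tendsto (fun ε : ℝ => ε * ‖u‖) (𝓝 0) (𝓝 (0 * ‖u‖)) := tendsto_id.mul_const _
    rw [zero_mul] at this
    exact this.mono_left nhdsWithin_le_nhds
  refine ge_of_tendsto hlim ?_
  filter_upwards [self_mem_nhdsWithin] with ε hε using key ε hε

/-- In finite dimensions the regular normal cone is the polar of the tangent cone. -/
lemma mem_regularNormalCone_iff [FiniteDimensional ℝ H] {C : Set H} {z v : H} :
    v ∈ regularNormalCone C z ↔ z ∈ C ∧ ∀ u ∈ bouligandTangentCone C z, inner ℝ v u ≤ 0 := by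
  refine ⟨fun h => ⟨h.1, fun u hu => inner_nonpos_of_mem_regularNormalCone h hu⟩,
    fun ⟨hz, hv⟩ => ⟨hz, fun ε hε => ?_⟩⟩
  -- If the `o`-estimate fails for some `ε`, the normalized differences along the bad points
  -- accumulate on the compact unit sphere, at a tangent `u` with `⟨v, u⟩ ≥ ε`.
  by_contra hcon
  rw [not_eventually] at hcon
  have : ProperSpace H := FiniteDimensional.proper ℝ H
  obtain ⟨z', hz', hP⟩ := exists_seq_forall_of_frequently hcon
  obtain ⟨hz'1, hz'2⟩ := tendsto_nhdsWithin_iff.1 hz'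
  -- Membership in `C` is only eventual; the shift by `N` makes it hold at all indices.
  obtain ⟨N, hN⟩ := eventually_atTop.1 hz'2
  have hne : ∀ k, 0 < ‖z' k - z‖ := fun k => by
    refine norm_pos_iff.2 fun h0 => hP k ?_
    simp [h0]
  have hmem : ∀ k, ‖z' k - z‖⁻¹ • (z' k - z) ∈ Metric.sphere (0 : H) 1 := fun k => by
    simp [norm_smul, inv_mul_cancel₀ (hne k).ne']
  obtain ⟨u, -, φ, hφ, hu⟩ := (isCompact_sphere (0 : H) 1).tendsto_subseq
    (fun k => hmem (k + N))
  have hshift : Tendsto (fun k => φ k + N) atTop atTop :=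
    (tendsto_add_atTop_nat N).comp hφ.tendsto_atTop
  have huT : u ∈ bouligandTangentCone C z := by
    refine ⟨fun k => ‖z' (φ k + N) - z‖, _, fun k => hne _, ?_, hu, fun k => ?_⟩
    · have := ((hz'1.comp hshift).sub_const z).norm
      simpa using this
    · simpa [smul_smul, mul_inv_cancel₀ (hne _).ne'] using hN (φ k + N) (by omega)
  have hge : ε ≤ inner ℝ v u := by
    refine ge_of_tendsto' (tendsto_const_nhds.inner hu) fun k => ?_
    have := not_le.1 (hP (φ k + N))
    simp only [Function.comp, inner_smul_right]
    rw [inv_mul_eq_div, le_div_iff₀ (hne _)]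
    exact this.le
  linarith [hv u huT]

/-! ### Invariance under linear isometries preserving the set -/

section Symmetry

variable {C : Set H} (e : H ≃ₗᵢ[ℝ] H)

lemma map_mem_bouligandTangentCone (hC : ∀ p ∈ C, e p ∈ C) {z u : H}
    (h : u ∈ bouligandTangentCone C z) : e u ∈ bouligandTangentCone C (e z) := by
  obtain ⟨t, u', ht, ht0, hu, hm⟩ := h
  exact ⟨t, fun k => e (u' k), ht, ht0, (e.continuous.tendsto u).comp hu, fun k => by
    simpa using hC _ (hm k)⟩

lemma map_mem_innerTangentCone (hC : ∀ p ∈ C, e p ∈ C) {z u : H}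
    (h : u ∈ innerTangentCone C z) : e u ∈ innerTangentCone C (e z) := by
  intro t ht ht0
  obtain ⟨u', hu, hm⟩ := h t ht ht0
  exact ⟨fun k => e (u' k), (e.continuous.tendsto u).comp hu, fun k => by
    simpa using hC _ (hm k)⟩

lemma map_mem_regularNormalCone (hC : ∀ p, e p ∈ C ↔ p ∈ C) {z v : H}
    (h : v ∈ regularNormalCone C z) : e v ∈ regularNormalCone C (e z) := by
  refine ⟨(hC z).2 h.1, fun ε hε => ?_⟩
  have hlim : Tendsto e.symm (𝓝[C] (e z)) (𝓝[C] z) := by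
    refine tendsto_nhdsWithin_iff.2 ⟨?_, ?_⟩
    · have := e.symm.continuous.tendsto (e z)
      rw [e.symm_apply_apply] at this
      exact this.mono_left nhdsWithin_le_nhds
    · filter_upwards [self_mem_nhdsWithin] with p hp
      exact (hC _).1 (by simpa using hp)
  filter_upwards [hlim.eventually (h.2 ε hε)] with p hp
  rw [← e.inner_map_map, ← e.norm_map (e.symm p - z)] at hp
  simpa using hp

lemma map_mem_limitingNormalCone (hC : ∀ p, e p ∈ C ↔ p ∈ C) {z v : H}
    (h : v ∈ limitingNormalCone C z) : e v ∈ limitingNormalCone C (e z) := by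
  obtain ⟨z', v', h1, h2, h3, h4⟩ := h
  exact ⟨fun k => e (z' k), fun k => e (v' k), fun k => (hC _).2 (h1 k),
    (e.continuous.tendsto z).comp h2, (e.continuous.tendsto v).comp h3,
    fun k => map_mem_regularNormalCone e hC (h4 k)⟩

lemma map_mem_directionalNormalCone (hC : ∀ p, e p ∈ C ↔ p ∈ C) {z d v : H}
    (h : v ∈ directionalNormalCone C z d) : e v ∈ directionalNormalCone C (e z) (e d) := by
  obtain ⟨t, d', v', ht, ht0, h2, h3, h4⟩ := h
  exact ⟨t, fun k => e (d' k), fun k => e (v' k), ht, ht0,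
    (e.continuous.tendsto d).comp h2, (e.continuous.tendsto v).comp h3,
    fun k => by simpa using map_mem_regularNormalCone e hC (h4 k)⟩

lemma map_mem_innerDirectionalNormalCone (hC : ∀ p, e p ∈ C ↔ p ∈ C) {z d v : H}
    (h : v ∈ innerDirectionalNormalCone C z d) :
    e v ∈ innerDirectionalNormalCone C (e z) (e d) := by
  intro t ht ht0
  obtain ⟨d', v', h2, h3, h4⟩ := h t ht ht0
  exact ⟨fun k => e (d' k), fun k => e (v' k),
    (e.continuous.tendsto d).comp h2, (e.continuous.tendsto v).comp h3,
    fun k => by simpa using map_mem_regularNormalCone e hC (h4 k)⟩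

end Symmetry

/-! ### Sets invariant under positive scaling -/

section Cone

variable {C : Set H}

lemma smul_mem_iff_of_cone (hC : ∀ p ∈ C, ∀ t : ℝ, 0 < t → t • p ∈ C) {t : ℝ} (ht : 0 < t)
    (p : H) : t • p ∈ C ↔ p ∈ C := by
  refine ⟨fun h => ?_, fun h => hC p h t ht⟩
  simpa [smul_smul, inv_mul_cancel₀ ht.ne'] using hC _ h t⁻¹ (inv_pos.2 ht)

/-- Scaling by `t` is a bijection of `C`, and both sides of the defining inequality are homogeneous
of degree one in `z' - z`. -/
lemma regularNormalCone_smul_of_cone (hC : ∀ p ∈ C, ∀ t : ℝ, 0 < t → t • p ∈ C) {t : ℝ}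
    (ht : 0 < t) {z v : H} (h : v ∈ regularNormalCone C z) :
    v ∈ regularNormalCone C (t • z) := by
  refine ⟨hC z h.1 t ht, fun ε hε => ?_⟩
  have hlim : Tendsto (fun p => t⁻¹ • p) (𝓝[C] (t • z)) (𝓝[C] z) := by
    refine tendsto_nhdsWithin_iff.2 ⟨?_, ?_⟩
    · have := (continuous_const_smul (T := H) t⁻¹).tendsto (t • z)
      rw [smul_smul, inv_mul_cancel₀ ht.ne', one_smul] at this
      exact this.mono_left nhdsWithin_le_nhds
    · filter_upwards [self_mem_nhdsWithin] with p hp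
      exact hC _ hp _ (inv_pos.2 ht)
  filter_upwards [hlim.eventually (h.2 ε hε)] with p hp
  have h1 : p - t • z = t • (t⁻¹ • p - z) := by
    rw [smul_sub, smul_smul, mul_inv_cancel₀ ht.ne', one_smul]
  rw [h1, inner_smul_right, norm_smul, Real.norm_of_nonneg ht.le]
  nlinarith

lemma bouligandTangentCone_zero_of_cone (hC : ∀ p ∈ C, ∀ t : ℝ, 0 < t → t • p ∈ C)
    (hcl : IsClosed C) : bouligandTangentCone C 0 ⊆ C := by
  rintro u ⟨t, u', ht, -, hu, hm⟩
  refine hcl.mem_of_tendsto hu (Eventually.of_forall fun k => ?_)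
  simpa [smul_mem_iff_of_cone hC (ht k)] using hm k

lemma subset_innerTangentCone_zero_of_cone (hC : ∀ p ∈ C, ∀ t : ℝ, 0 < t → t • p ∈ C) :
    C ⊆ innerTangentCone C 0 := fun u hu t ht _ =>
  ⟨fun _ => u, tendsto_const_nhds, fun k => by simpa using hC u hu _ (ht k)⟩

/-- Regular normals at `t k • d' k` are regular normals at `d' k`, so the step sizes drop out.
Together with `limitingNormalCone_subset_innerDirectional_zero_of_cone` this settles the directions
at the origin. -/
lemma directionalNormalCone_zero_of_cone (hC : ∀ p ∈ C, ∀ t : ℝ, 0 < t → t • p ∈ C) (d : H) :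
    directionalNormalCone C 0 d ⊆ limitingNormalCone C d := by
  rintro v ⟨t, d', v', ht, -, hd, hv, hm⟩
  have hm' : ∀ k, v' k ∈ regularNormalCone C (d' k) := fun k => by
    have := regularNormalCone_smul_of_cone hC (inv_pos.2 (ht k)) (hm k)
    simpa [smul_smul, inv_mul_cancel₀ (ht k).ne'] using this
  exact ⟨d', v', fun k => (hm' k).1, hd, hv, hm'⟩

lemma limitingNormalCone_subset_innerDirectional_zero_of_cone
    (hC : ∀ p ∈ C, ∀ t : ℝ, 0 < t → t • p ∈ C) (d : H) :
    limitingNormalCone C d ⊆ innerDirectionalNormalCone C 0 d := by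
  rintro v ⟨z', v', -, hd, hv, hm⟩ t ht -
  exact ⟨z', v', hd, hv, fun k => by
    simpa using regularNormalCone_smul_of_cone hC (ht k) (hm k)⟩

lemma limitingNormalCone_subset_zero_of_cone
    (hC : ∀ p ∈ C, ∀ t : ℝ, 0 < t → t • p ∈ C) (d : H) :
    limitingNormalCone C d ⊆ limitingNormalCone C 0 :=
  (limitingNormalCone_subset_innerDirectional_zero_of_cone hC d).trans
    ((innerDirectionalNormalCone_subset C 0 d).trans
      (directionalNormalCone_subset_limiting C 0 d))

end Cone

end VariationalLemmas

/-! ### Algebra of the second-order cone and of complementary pairs -/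

section SOCAlgebra

variable {m : ℕ}

lemma SOCSpace.ext' {x y : SOCSpace m} (h1 : x.fst = y.fst) (h2 : x.snd = y.snd) : x = y :=
  (WithLp.ofLp_injective 2) (Prod.ext h1 h2)

lemma SOCSpace.inner_eq (x y : SOCSpace m) :
    inner ℝ x y = x.fst * y.fst + inner ℝ x.snd y.snd := by
  simp [WithLp.prod_inner_apply, mul_comm]

namespace SOCSpace

@[simp] lemma hat_fst (x : SOCSpace m) : x.hat.fst = x.fst := rfl
@[simp] lemma hat_snd (x : SOCSpace m) : x.hat.snd = -x.snd := rfl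
@[simp] lemma hat_hat (x : SOCSpace m) : x.hat.hat = x := ext' rfl (by simp)
@[simp] lemma hat_add (x y : SOCSpace m) : (x + y).hat = x.hat + y.hat :=
  ext' rfl (by simp [add_comm])
@[simp] lemma hat_sub (x y : SOCSpace m) : (x - y).hat = x.hat - y.hat :=
  ext' rfl (by simp [sub_eq_add_neg])
@[simp] lemma hat_smul (c : ℝ) (x : SOCSpace m) : (c • x).hat = c • x.hat :=
  ext' rfl (by simp)

@[fun_prop]
lemma continuous_hat : Continuous (hat : SOCSpace m → SOCSpace m) := by
  unfold hat; fun_prop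

lemma inner_hat_left (x y : SOCSpace m) : inner ℝ x.hat y = inner ℝ x y.hat := by
  simp

/-- The nonzero boundary points of the second-order cone. -/
def IsBoundary (x : SOCSpace m) : Prop := 0 < x.fst ∧ ‖x.snd‖ = x.fst

namespace IsBoundary

variable {x : SOCSpace m}

lemma mem (hx : x.IsBoundary) : x ∈ secondOrderCone m := hx.2.le

lemma hat (hx : x.IsBoundary) : x.hat.IsBoundary := by
  simpa [IsBoundary] using hx

lemma inner_hat_self (hx : x.IsBoundary) : inner ℝ x x.hat = 0 := by
  simp [hx.2, sq]

lemma inner_self (hx : x.IsBoundary) : inner ℝ x x = 2 * x.fst ^ 2 := by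
  rw [inner_eq, real_inner_self_eq_norm_sq, hx.2]; ring

lemma inner_hat_hat (hx : x.IsBoundary) : inner ℝ x.hat x.hat = 2 * x.fst ^ 2 :=
  hx.hat.inner_self

lemma smul (hx : x.IsBoundary) {c : ℝ} (hc : 0 < c) : (c • x).IsBoundary := by
  refine ⟨by simpa using mul_pos hc hx.1, ?_⟩
  simp [norm_smul, abs_of_pos hc, hx.2]

end IsBoundary

end SOCSpace

open SOCSpace

lemma smul_mem_secondOrderCone {x : SOCSpace m} (hx : x ∈ secondOrderCone m) {c : ℝ}
    (hc : 0 ≤ c) : c • x ∈ secondOrderCone m := by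
  have hx' : ‖x.snd‖ ≤ x.fst := hx
  simpa [secondOrderCone, norm_smul, abs_of_nonneg hc] using mul_le_mul_of_nonneg_left hx' hc

lemma fst_nonneg_of_mem {x : SOCSpace m} (hx : x ∈ secondOrderCone m) : 0 ≤ x.fst :=
  (norm_nonneg _).trans hx

lemma eq_zero_of_mem_of_fst_nonpos {x : SOCSpace m} (hx : x ∈ secondOrderCone m)
    (h : x.fst ≤ 0) : x = 0 := by
  have h1 : x.fst = 0 := le_antisymm h (fst_nonneg_of_mem hx)
  have h2 : ‖x.snd‖ ≤ x.fst := hx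
  exact SOCSpace.ext' h1 (norm_le_zero_iff.1 (h2.trans h))

lemma fst_pos_of_mem_of_ne_zero {x : SOCSpace m} (hx : x ∈ secondOrderCone m)
    (h : x ≠ 0) : 0 < x.fst :=
  not_le.1 fun h' => h (eq_zero_of_mem_of_fst_nonpos hx h')

lemma zero_mem_secondOrderCone : (0 : SOCSpace m) ∈ secondOrderCone m := by
  simp [secondOrderCone]

lemma inner_nonneg_of_mem_secondOrderCone {x y : SOCSpace m} (hx : x ∈ secondOrderCone m)
    (hy : y ∈ secondOrderCone m) : 0 ≤ inner ℝ x y := by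
  have h := abs_le.1 (abs_real_inner_le_norm x.snd y.snd)
  have := mul_le_mul hx hy (norm_nonneg _) (fst_nonneg_of_mem hx)
  rw [inner_eq]; linarith [h.1]

/-- Self-duality of the second-order cone. -/
lemma neg_mem_secondOrderCone_of_polar {u : SOCSpace m}
    (h : ∀ x ∈ secondOrderCone m, inner ℝ u x ≤ 0) : -u ∈ secondOrderCone m := by
  have h1 : u.fst ≤ 0 := by
    simpa [inner_eq] using h (WithLp.toLp 2 (1, 0)) (by simp [secondOrderCone])
  have h2 : u.fst * ‖u.snd‖ + ‖u.snd‖ ^ 2 ≤ 0 := by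
    rw [← real_inner_self_eq_norm_sq u.snd]
    have := h (WithLp.toLp 2 (‖u.snd‖, u.snd)) (by simp [secondOrderCone])
    rw [inner_eq] at this
    exact this
  change ‖(-u).snd‖ ≤ (-u).fst
  simp only [WithLp.neg_snd, WithLp.neg_fst, norm_neg]
  rcases (norm_nonneg u.snd).eq_or_lt with h0 | h0
  · linarith
  · have : u.fst + ‖u.snd‖ ≤ 0 := by
      by_contra hc
      have := mul_pos (not_le.1 hc) h0
      nlinarith
    linarith

lemma isClosed_secondOrderCone : IsClosed (secondOrderCone m) := by
  unfold secondOrderCone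
  exact isClosed_le (by fun_prop) (by fun_prop)

lemma isBoundary_of_mem_frontier {x : SOCSpace m} (hx : x ∈ frontier (secondOrderCone m) \ {0}) :
    x.IsBoundary := by
  have h : ‖x.snd‖ = x.fst :=
    frontier_le_subset_eq (f := fun x : SOCSpace m => ‖x.snd‖) (g := fun x : SOCSpace m => x.fst)
      (by fun_prop) (by fun_prop) hx.1
  exact ⟨fst_pos_of_mem_of_ne_zero h.le hx.2, h⟩

/-- Moving an interior point slightly against `e` turns a weak inequality defining `S` into a strict
one. This serves both the cone and its tangent half-space. -/
lemma exists_pos_sub_smul_mem {E : Type*} [NormedAddCommGroup E] [NormedSpace ℝ E] {S : Set E}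
    {x : E} (hx : x ∈ interior S) (e : E) : ∃ t : ℝ, 0 < t ∧ x - t • e ∈ S := by
  have h : Tendsto (fun t : ℝ => x - t • e) (𝓝 0) (𝓝 x) := by
    have : Continuous fun t : ℝ => x - t • e := by fun_prop
    simpa using this.tendsto 0
  have h1 := (h.mono_left nhdsWithin_le_nhds : Tendsto _ (𝓝[>] (0 : ℝ)) _).eventually
    (mem_interior_iff_mem_nhds.1 hx)
  obtain ⟨t, ht, ht'⟩ := (h1.and self_mem_nhdsWithin).exists
  exact ⟨t, ht', ht⟩

lemma norm_snd_lt_of_mem_interior {x : SOCSpace m} (hx : x ∈ interior (secondOrderCone m)) :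
    ‖x.snd‖ < x.fst := by
  obtain ⟨t, ht, h⟩ := exists_pos_sub_smul_mem hx (WithLp.toLp 2 (1, 0))
  have h' : ‖x.snd‖ ≤ x.fst - t := by simpa [secondOrderCone] using h
  linarith

lemma mem_socComplementaritySet_iff {x y : SOCSpace m} :
    socPair x y ∈ socComplementaritySet m ↔
      x ∈ secondOrderCone m ∧ y ∈ secondOrderCone m ∧ inner ℝ x y = 0 := Iff.rfl

lemma isClosed_socComplementaritySet : IsClosed (socComplementaritySet m) := by
  have h1 := (isClosed_secondOrderCone (m := m)).preimage
    (WithLp.continuous_fst 2 (SOCSpace m) (SOCSpace m))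
  have h2 := (isClosed_secondOrderCone (m := m)).preimage
    (WithLp.continuous_snd 2 (SOCSpace m) (SOCSpace m))
  have h3 : IsClosed {p : WithLp 2 (SOCSpace m × SOCSpace m) | inner ℝ p.fst p.snd = 0} :=
    isClosed_eq (by fun_prop) (by fun_prop)
  exact h1.inter (h2.inter h3)

lemma smul_mem_socComplementaritySet :
    ∀ p ∈ socComplementaritySet m, ∀ t : ℝ, 0 < t → t • p ∈ socComplementaritySet m := by
  rintro p ⟨h1, h2, h3⟩ t ht
  refine ⟨smul_mem_secondOrderCone h1 ht.le, smul_mem_secondOrderCone h2 ht.le, ?_⟩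
  simp [inner_smul_left, inner_smul_right, h3]

lemma socPair_zero_right_mem {x : SOCSpace m} (hx : x ∈ secondOrderCone m) :
    socPair x 0 ∈ socComplementaritySet m :=
  ⟨hx, zero_mem_secondOrderCone, inner_zero_right _⟩

lemma socPair_zero_left_mem {x : SOCSpace m} (hx : x ∈ secondOrderCone m) :
    socPair 0 x ∈ socComplementaritySet m :=
  ⟨zero_mem_secondOrderCone, hx, inner_zero_left _⟩

lemma SOCSpace.IsBoundary.socPair_mem {x : SOCSpace m} (hx : x.IsBoundary) {c : ℝ} (hc : 0 ≤ c) :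
    socPair x (c • x.hat) ∈ socComplementaritySet m :=
  ⟨hx.mem, smul_mem_secondOrderCone hx.hat.mem hc, by
    simp [socPair, inner_smul_right, hx.inner_hat_self]⟩

/-- Complementary vectors of the cone are, up to reflection, parallel. -/
lemma fst_smul_eq_of_mem {x y : SOCSpace m} (h : socPair x y ∈ socComplementaritySet m) :
    y.fst • x = x.fst • y.hat := by
  obtain ⟨hx, hy, hxy⟩ := mem_socComplementaritySet_iff.1 h
  have hx' : ‖x.snd‖ ≤ x.fst := hx
  have hy' : ‖y.snd‖ ≤ y.fst := hy
  refine SOCSpace.ext' (by simp [mul_comm]) ?_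
  -- Since `⟨x₂, y₂⟩ = -x₁y₁`, the square expands to `y₁²‖x₂‖² + x₁²‖y₂‖² - 2x₁²y₁²`, which is
  -- nonpositive because `‖x₂‖ ≤ x₁` and `‖y₂‖ ≤ y₁`.
  have hz : ‖y.fst • x.snd + x.fst • y.snd‖ ^ 2 ≤ 0 := by
    rw [norm_add_sq_real, norm_smul, norm_smul, inner_smul_left, inner_smul_right,
      mul_pow, mul_pow, Real.norm_eq_abs, Real.norm_eq_abs, sq_abs, sq_abs]
    rw [inner_eq] at hxy
    have e : inner ℝ x.snd y.snd = -(x.fst * y.fst) := by linarith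
    have h1 := mul_le_mul_of_nonneg_left (pow_le_pow_left₀ (norm_nonneg _) hx' 2)
      (sq_nonneg y.fst)
    have h2 := mul_le_mul_of_nonneg_left (pow_le_pow_left₀ (norm_nonneg _) hy' 2)
      (sq_nonneg x.fst)
    rw [e]
    simp only [conj_trivial]
    nlinarith
  have hz' : y.fst • x.snd + x.fst • y.snd = 0 := by
    simpa using le_antisymm hz (sq_nonneg _)
  simpa using eq_neg_of_add_eq_zero_left hz'

lemma eq_div_smul_hat_of_mem {x y : SOCSpace m} (h : socPair x y ∈ socComplementaritySet m)
    (hx : 0 < x.fst) : y = (y.fst / x.fst) • x.hat := by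
  have := congrArg SOCSpace.hat (fst_smul_eq_of_mem h)
  simp only [hat_smul, hat_hat] at this
  rw [div_eq_inv_mul, mul_smul, this, smul_smul, inv_mul_cancel₀ hx.ne', one_smul]

/-- As `y` is a positive multiple of `x̂`, orthogonality gives `⟨x, x̂⟩ = x₁² - ‖x₂‖² = 0`. -/
lemma isBoundary_of_mem {x y : SOCSpace m} (h : socPair x y ∈ socComplementaritySet m)
    (hx : 0 < x.fst) (hy : 0 < y.fst) : x.IsBoundary := by
  obtain ⟨hxK, -, hxy⟩ := mem_socComplementaritySet_iff.1 h
  refine ⟨hx, le_antisymm hxK ?_⟩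
  rw [eq_div_smul_hat_of_mem h hx, inner_smul_right] at hxy
  have h0 : inner ℝ x x.hat = 0 := (mul_eq_zero.1 hxy).resolve_left (by positivity)
  simp only [inner_eq, hat_fst, hat_snd, inner_neg_right, real_inner_self_eq_norm_sq] at h0
  nlinarith [norm_nonneg x.snd]

lemma eq_zero_of_norm_snd_lt {x y : SOCSpace m} (h : socPair x y ∈ socComplementaritySet m)
    (hx : ‖x.snd‖ < x.fst) : y = 0 := by
  by_contra hy
  have hx0 : 0 < x.fst := (norm_nonneg _).trans_lt hx
  exact hx.ne (isBoundary_of_mem h hx0 (fst_pos_of_mem_of_ne_zero h.2.1 hy)).2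

/-- The symmetry that reduces the points with `x = 0`, `y ≠ 0` to those with `x ≠ 0`, `y = 0`. -/
lemma swap_mem_socComplementaritySet (p : WithLp 2 (SOCSpace m × SOCSpace m)) :
    LinearIsometryEquiv.withLpProdComm 2 ℝ (SOCSpace m) (SOCSpace m) p
      ∈ socComplementaritySet m ↔ p ∈ socComplementaritySet m := by
  change (_ ∧ _ ∧ _) ↔ (_ ∧ _ ∧ _)
  simp only [LinearIsometryEquiv.withLpProdComm_apply]
  rw [real_inner_comm]
  tauto

end SOCAlgebra

/-! ### Curves in the cone and tangent cones -/

section SOCTangents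

variable {m : ℕ}

open SOCSpace

/-- A curve in the second-order cone that starts at the boundary point `x` with velocity `d`. -/
noncomputable def socCurve (x d : SOCSpace m) (a t : ℝ) : SOCSpace m :=
  WithLp.toLp 2 (‖x.snd + t • d.snd‖ + t * (inner ℝ d x.hat / x.fst + a * t), x.snd + t • d.snd)

@[simp] lemma socCurve_fst (x d : SOCSpace m) (a t : ℝ) : (socCurve x d a t).fst =
    ‖x.snd + t • d.snd‖ + t * (inner ℝ d x.hat / x.fst + a * t) := rfl

@[simp] lemma socCurve_snd (x d : SOCSpace m) (a t : ℝ) :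
    (socCurve x d a t).snd = x.snd + t • d.snd := rfl

lemma continuous_socCurve (x d : SOCSpace m) (a : ℝ) : Continuous (socCurve x d a) := by
  unfold socCurve; fun_prop

lemma SOCSpace.IsBoundary.socCurve_zero {x : SOCSpace m} (hx : x.IsBoundary) (d : SOCSpace m)
    (a : ℝ) : socCurve x d a 0 = x :=
  SOCSpace.ext' (by simp [hx.2]) (by simp)

lemma HasDerivAt.toLp_prod {E F : Type*} [NormedAddCommGroup E] [NormedSpace ℝ E]
    [NormedAddCommGroup F] [NormedSpace ℝ F] {f : ℝ → E} {g : ℝ → F} {f' : E} {g' : F} {t : ℝ}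
    (hf : HasDerivAt f f' t) (hg : HasDerivAt g g' t) :
    HasDerivAt (fun t => WithLp.toLp 2 (f t, g t)) (WithLp.toLp 2 (f', g')) t :=
  (WithLp.prodContinuousLinearEquiv 2 ℝ E F).symm.hasFDerivAt.comp_hasDerivAt t (hf.prodMk hg)

/-- The norm has derivative `⟨x₂, d₂⟩ / x₁`, and the linear term `⟨d, x̂⟩ / x₁` is exactly what is
missing from `d₁`. The parameter `a` acts at second order only: `a > 0` pushes the curve into the
interior without changing its velocity. -/
lemma SOCSpace.IsBoundary.hasDerivAt_socCurve {x : SOCSpace m} (hx : x.IsBoundary)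
    (d : SOCSpace m) (a : ℝ) : HasDerivAt (socCurve x d a) d 0 := by
  have hg : HasDerivAt (fun t : ℝ => x.snd + t • d.snd) d.snd 0 := by
    simpa using ((hasDerivAt_id (0 : ℝ)).smul_const d.snd).const_add x.snd
  have hn : HasDerivAt (fun t : ℝ => ‖x.snd + t • d.snd‖) (inner ℝ x.snd d.snd / x.fst) 0 := by
    have h := hg.norm_sq.sqrt (by simpa [hx.2] using hx.1.ne')
    simp only [zero_smul, add_zero, Real.sqrt_sq (norm_nonneg _), hx.2] at h
    rwa [mul_div_mul_left _ _ two_ne_zero, Real.sqrt_sq hx.1.le] at h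
  have hl : HasDerivAt (fun t : ℝ => t * (inner ℝ d x.hat / x.fst + a * t))
      (inner ℝ d x.hat / x.fst) 0 := by
    generalize inner ℝ d x.hat / x.fst = g
    have := (hasDerivAt_id' (0 : ℝ)).mul (((hasDerivAt_id' (0 : ℝ)).const_mul a).const_add g)
    simp only [mul_one, mul_zero, add_zero, one_mul, zero_mul] at this
    exact this
  have h := (hn.add hl).toLp_prod hg
  have hx' := hx.1.ne'
  have he : inner ℝ x.snd d.snd / x.fst + inner ℝ d x.hat / x.fst = d.fst := by
    simp only [inner_eq, hat_fst, hat_snd, inner_neg_right]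
    rw [real_inner_comm]
    field_simp
    ring
  rw [he] at h
  exact h

lemma socCurve_mem {x d : SOCSpace m} (hx : x.IsBoundary) (hd : 0 ≤ inner ℝ d x.hat) {a t : ℝ}
    (ha : 0 ≤ a) (ht : 0 ≤ t) : socCurve x d a t ∈ secondOrderCone m := by
  have := mul_nonneg ht (add_nonneg (div_nonneg hd hx.1.le) (mul_nonneg ha ht))
  simpa [secondOrderCone] using this

lemma norm_snd_socCurve_lt {x d : SOCSpace m} (hx : x.IsBoundary) (hd : 0 ≤ inner ℝ d x.hat)
    {a t : ℝ} (ha : 0 < a) (ht : 0 < t) :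
    ‖(socCurve x d a t).snd‖ < (socCurve x d a t).fst := by
  have := mul_pos ht (add_pos_of_nonneg_of_pos (div_nonneg hd hx.1.le) (mul_pos ha ht))
  simpa using this

lemma eventually_isBoundary_socCurve {x d : SOCSpace m} (hx : x.IsBoundary)
    (hd : inner ℝ d x.hat = 0) :
    ∀ᶠ t in 𝓝[>] (0 : ℝ), (socCurve x d 0 t).IsBoundary := by
  have hc : Continuous fun t => (socCurve x d 0 t).fst :=
    (WithLp.continuous_fst 2 _ _).comp (continuous_socCurve x d 0)
  have h0 : 0 < (socCurve x d 0 0).fst := by rw [hx.socCurve_zero]; exact hx.1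
  filter_upwards [nhdsWithin_le_nhds (hc.continuousAt.eventually_const_lt h0)] with t ht
  exact ⟨ht, by simp [hd]⟩

lemma tendsto_socCurve {x : SOCSpace m} (hx : x.IsBoundary) (d : SOCSpace m) (a : ℝ) :
    Tendsto (socCurve x d a) (𝓝[>] 0) (𝓝 x) := by
  have := (continuous_socCurve x d a).tendsto 0
  rw [hx.socCurve_zero] at this
  exact this.mono_left nhdsWithin_le_nhds

/-- Points of the cone pair nonnegatively with `x̂`, which is orthogonal to `x`; conversely
`socCurve` attains every direction of the half-space. -/
lemma SOCSpace.IsBoundary.bouligandTangentCone_eq {x : SOCSpace m} (hx : x.IsBoundary) :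
    bouligandTangentCone (secondOrderCone m) x = {d | 0 ≤ inner ℝ d x.hat} := by
  refine Set.Subset.antisymm ?_ fun d hd => ?_
  · rintro d ⟨t, d', ht, -, hd, hm⟩
    have hlim : Tendsto (fun k => inner ℝ (d' k) x.hat) _ _ := hd.inner tendsto_const_nhds
    refine ge_of_tendsto' hlim fun k => ?_
    have := inner_nonneg_of_mem_secondOrderCone (hm k) hx.hat.mem
    rw [inner_add_left, hx.inner_hat_self, zero_add, inner_smul_left] at this
    exact nonneg_of_mul_nonneg_right this (ht k)
  · refine innerTangentCone_subset _ _ (mem_innerTangentCone_of_curve hx.mem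
      (hx.hasDerivAt_socCurve d 0).tendsto_inv_smul_sub_right (hx.socCurve_zero d 0) ?_)
    filter_upwards [self_mem_nhdsWithin] with t ht
    exact socCurve_mem hx hd le_rfl (Set.mem_Ioi.1 ht).le

/-- Expansion along a line of the quadratic form `x₁² - ‖x₂‖²`, whose sign separates interior from
boundary. -/
lemma inner_add_smul_hat (x d : SOCSpace m) (t : ℝ) :
    inner ℝ (x + t • d) (x + t • d).hat =
      inner ℝ x x.hat + t * (2 * inner ℝ d x.hat + t * inner ℝ d d.hat) := by
  simp only [hat_add, hat_smul, inner_add_left, inner_add_right, inner_smul_left,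
    inner_smul_right, conj_trivial]
  rw [← inner_hat_left x d, real_inner_comm d x.hat]
  ring

lemma socPair_add_smul (x y : SOCSpace m) (t : ℝ) (p : WithLp 2 (SOCSpace m × SOCSpace m)) :
    socPair x y + t • p = socPair (x + t • p.fst) (y + t • p.snd) := rfl

lemma tendsto_fst_snd {ι E F : Type*} [TopologicalSpace E] [TopologicalSpace F] {l : Filter ι}
    {p' : ι → WithLp 2 (E × F)} {p : WithLp 2 (E × F)} (h : Tendsto p' l (𝓝 p)) :
    Tendsto (fun k => (p' k).fst) l (𝓝 p.fst) ∧ Tendsto (fun k => (p' k).snd) l (𝓝 p.snd) :=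
  ⟨((WithLp.continuous_fst 2 E F).tendsto p).comp h,
    ((WithLp.continuous_snd 2 E F).tendsto p).comp h⟩

/-- The linearization of `y₁ x = x₁ ŷ` at `(x, c x̂)`, solved for the second component. -/
lemma snd_eq_of_mem_bouligandTangentCone {x : SOCSpace m} (hx : 0 < x.fst) {c : ℝ}
    {q : WithLp 2 (SOCSpace m × SOCSpace m)}
    (hq : q ∈ bouligandTangentCone (socComplementaritySet m) (socPair x (c • x.hat))) :
    q.snd = c • q.fst.hat + ((q.snd.fst - c * q.fst.fst) / x.fst) • x.hat := by
  obtain ⟨t, q', ht, ht0, hq', hm⟩ := hq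
  obtain ⟨h1, h2⟩ := tendsto_fst_snd hq'
  have h11 := (tendsto_fst_snd h1).1
  have h21 := (tendsto_fst_snd h2).1
  have h2h := (continuous_hat.tendsto q.snd).comp h2
  -- The identity at the perturbed pair minus the identity at `(x, c x̂)`, divided by `t k`.
  have key : ∀ k, (q' k).snd.fst • x + (c * x.fst) • (q' k).fst
      + (t k * (q' k).snd.fst) • (q' k).fst
      = x.fst • (q' k).snd.hat + (c * (q' k).fst.fst) • x
        + (t k * (q' k).fst.fst) • (q' k).snd.hat := fun k => by
    have h := fst_smul_eq_of_mem (by simpa only [socPair_add_smul] using hm k)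
    simp only [hat_add, hat_smul, hat_hat, WithLp.add_fst, WithLp.smul_fst, hat_fst,
      smul_eq_mul] at h
    have ht' := (ht k).ne'
    refine smul_right_injective _ ht' ?_
    linear_combination (norm := module) h
  have hlim := tendsto_nhds_unique
    (((h21.smul_const x).add (h1.const_smul (c * x.fst))).add ((ht0.mul h21).smul h1))
    (((((h2h.const_smul x.fst).add ((h11.const_mul c).smul_const x)).add
      ((ht0.mul h11).smul h2h))).congr fun k => (key k).symm)
  simp only [zero_mul, zero_smul, add_zero] at hlim
  have h := congrArg SOCSpace.hat hlim
  simp only [hat_add, hat_smul, hat_hat] at h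
  have hx' := hx.ne'
  have h3 : x.fst • q.snd = (c * x.fst) • q.fst.hat + (q.snd.fst - c * q.fst.fst) • x.hat := by
    linear_combination (norm := module) -h
  have h4 := congrArg (fun y => x.fst⁻¹ • y) h3
  simp only [smul_add, smul_smul, inv_mul_cancel₀ hx', one_smul] at h4
  refine h4.trans ?_
  congr 2 <;> field_simp

/-- If `c > 0`, or `c = 0` and the second velocity does not vanish, the perturbed second component
is eventually nonzero. This keeps the first one on the boundary, so the linear coefficient of the
quadratic form must vanish. -/
lemma inner_hat_eq_zero_of_mem_bouligandTangentCone {x : SOCSpace m} (hx : x.IsBoundary) {c : ℝ}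
    (hc : 0 ≤ c) {q : WithLp 2 (SOCSpace m × SOCSpace m)}
    (hq : q ∈ bouligandTangentCone (socComplementaritySet m) (socPair x (c • x.hat)))
    (hcq : c = 0 → q.snd.fst ≠ 0) : inner ℝ q.fst x.hat = 0 := by
  obtain ⟨t, q', ht, ht0, hq', hm⟩ := hq
  obtain ⟨h1, h2⟩ := tendsto_fst_snd hq'
  have h11 := (tendsto_fst_snd h1).1
  have h21 := (tendsto_fst_snd h2).1
  have hy : ∀ᶠ k in atTop, 0 < (c • x.hat + t k • (q' k).snd).fst := by
    rcases hc.eq_or_lt with rfl | hc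
    · filter_upwards [h21.eventually_ne (hcq rfl)] with k hk
      have h := fst_nonneg_of_mem (hm k).2.1
      refine lt_of_le_of_ne h ?_
      simpa using ⟨(ht k).ne', hk⟩
    · have : Tendsto (fun k => c * x.fst + t k * (q' k).snd.fst) atTop (𝓝 (c * x.fst)) := by
        simpa using tendsto_const_nhds.add (ht0.mul h21)
      simpa using this.eventually_const_lt (mul_pos hc hx.1)
  have hx0 : ∀ᶠ k in atTop, 0 < (x + t k • (q' k).fst).fst := by
    have : Tendsto (fun k => x.fst + t k * (q' k).fst.fst) atTop (𝓝 x.fst) := by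
      simpa using tendsto_const_nhds.add (ht0.mul h11)
    simpa using this.eventually_const_lt hx.1
  have hlim : Tendsto (fun k => 2 * inner ℝ (q' k).fst x.hat +
      t k * inner ℝ (q' k).fst (q' k).fst.hat) atTop (𝓝 (2 * inner ℝ q.fst x.hat)) := by
    have h3 : Tendsto (fun k => inner ℝ (q' k).fst x.hat) atTop (𝓝 (inner ℝ q.fst x.hat)) :=
      h1.inner tendsto_const_nhds
    have := (h3.const_mul 2).add (ht0.mul (h1.inner ((continuous_hat.tendsto q.fst).comp h1)))
    rwa [zero_mul, add_zero] at this
  have hzero : ∀ᶠ k in atTop, 2 * inner ℝ (q' k).fst x.hat +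
      t k * inner ℝ (q' k).fst (q' k).fst.hat = 0 := by
    filter_upwards [hy, hx0] with k hk1 hk2
    have hb := (isBoundary_of_mem (hm k) hk2 hk1).inner_hat_self
    change inner ℝ (x + t k • (q' k).fst) (x + t k • (q' k).fst).hat = 0 at hb
    rw [inner_add_smul_hat, hx.inner_hat_self, zero_add] at hb
    exact (mul_eq_zero.1 hb).resolve_left (ht k).ne'
  have := tendsto_nhds_unique hlim (tendsto_const_nhds.congr' (hzero.mono fun k hk => hk.symm))
  linarith

lemma fst_mem_of_mem_bouligandTangentCone {x y : SOCSpace m}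
    {q : WithLp 2 (SOCSpace m × SOCSpace m)}
    (hq : q ∈ bouligandTangentCone (socComplementaritySet m) (socPair x y)) :
    q.fst ∈ bouligandTangentCone (secondOrderCone m) x := by
  obtain ⟨t, q', ht, ht0, hq', hm⟩ := hq
  exact ⟨t, _, ht, ht0, (tendsto_fst_snd hq').1, fun k => (hm k).1⟩

/-- The curve of boundary pairs with velocity `(d, c d̂ + s x̂)`. -/
noncomputable def socPairCurve (x d : SOCSpace m) (c s t : ℝ) : WithLp 2 (SOCSpace m × SOCSpace m) :=
  socPair (socCurve x d 0 t) ((c + t * (s + t)) • (socCurve x d 0 t).hat)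

lemma SOCSpace.IsBoundary.socPairCurve_zero {x : SOCSpace m} (hx : x.IsBoundary) (d : SOCSpace m)
    (c s : ℝ) : socPairCurve x d c s 0 = socPair x (c • x.hat) := by
  simp [socPairCurve, hx.socCurve_zero]

lemma HasDerivAt.hat {f : ℝ → SOCSpace m} {f' : SOCSpace m} {t : ℝ} (hf : HasDerivAt f f' t) :
    HasDerivAt (fun t => (f t).hat) f'.hat t := by
  let L : SOCSpace m →ₗ[ℝ] SOCSpace m :=
    { toFun := SOCSpace.hat, map_add' := hat_add, map_smul' := hat_smul }
  exact (⟨L, continuous_hat⟩ : SOCSpace m →L[ℝ] SOCSpace m).hasFDerivAt.comp_hasDerivAt t hf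

lemma tendsto_slope_toLp_prod {E F : Type*} [NormedAddCommGroup E] [InnerProductSpace ℝ E]
    [NormedAddCommGroup F] [InnerProductSpace ℝ F] {f : ℝ → E} {g : ℝ → F} {f' : E} {g' : F}
    (hf : HasDerivAt f f' 0) (hg : HasDerivAt g g' 0) :
    Tendsto (fun t : ℝ => t⁻¹ • (WithLp.toLp 2 (f t, g t) - WithLp.toLp 2 (f 0, g 0)))
      (𝓝[>] 0) (𝓝 (WithLp.toLp 2 (f', g'))) :=
  ((WithLp.prod_continuous_toLp 2 E F).tendsto (f', g')).comp
    (hf.tendsto_inv_smul_sub_right.prodMk_nhds hg.tendsto_inv_smul_sub_right)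

lemma SOCSpace.IsBoundary.tendsto_slope_socPairCurve {x : SOCSpace m} (hx : x.IsBoundary)
    (d : SOCSpace m) (c s : ℝ) :
    Tendsto (fun t : ℝ => t⁻¹ • (socPairCurve x d c s t - socPairCurve x d c s 0)) (𝓝[>] 0)
      (𝓝 (socPair d (c • d.hat + s • x.hat))) := by
  have h := hx.hasDerivAt_socCurve d 0
  have hs : HasDerivAt (fun t : ℝ => c + t * (s + t)) s 0 := by
    have := ((hasDerivAt_id' (0 : ℝ)).mul ((hasDerivAt_id' (0 : ℝ)).const_add s)).const_add c
    simp only [one_mul, zero_mul, add_zero] at this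
    exact this
  have h2 := hs.smul h.hat
  simp only [hx.socCurve_zero, zero_mul, add_zero] at h2
  exact tendsto_slope_toLp_prod h h2

/-- The reason for the `t²` term in `socPairCurve`: it does not affect the velocity, yet keeps the
second component nonzero even when `c = s = 0`. -/
lemma eventually_coeff_pos {c s : ℝ} (hc : 0 ≤ c) (hcs : c = 0 → 0 ≤ s) :
    ∀ᶠ t in 𝓝[>] (0 : ℝ), 0 < c + t * (s + t) := by
  rcases hc.eq_or_lt with rfl | hc
  · filter_upwards [self_mem_nhdsWithin] with t ht
    simpa using mul_pos (Set.mem_Ioi.1 ht) (add_pos_of_nonneg_of_pos (hcs rfl) ht)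
  · have : Continuous fun t : ℝ => c + t * (s + t) := by fun_prop
    exact nhdsWithin_le_nhds (this.continuousAt.eventually_const_lt (by simpa using hc))

lemma mem_innerTangentCone_boundary {x : SOCSpace m} (hx : x.IsBoundary) {c : ℝ} (hc : 0 ≤ c)
    {d : SOCSpace m} (hd : inner ℝ d x.hat = 0) {s : ℝ} (hs : c = 0 → 0 ≤ s) :
    socPair d (c • d.hat + s • x.hat) ∈
      innerTangentCone (socComplementaritySet m) (socPair x (c • x.hat)) := by
  refine mem_innerTangentCone_of_curve (hx.socPair_mem hc) (hx.tendsto_slope_socPairCurve d c s)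
    (hx.socPairCurve_zero d c s) ?_
  filter_upwards [eventually_isBoundary_socCurve hx hd, eventually_coeff_pos hc hs] with t h1 h2
  exact h1.socPair_mem h2.le

lemma mem_innerTangentCone_right_zero {x : SOCSpace m} (hx : x.IsBoundary)
    {d : SOCSpace m} (hd : 0 ≤ inner ℝ d x.hat) :
    socPair d 0 ∈ innerTangentCone (socComplementaritySet m) (socPair x 0) := by
  refine mem_innerTangentCone_of_curve (γ := fun t => socPair (socCurve x d 0 t) 0)
    (socPair_zero_right_mem hx.mem)
    (tendsto_slope_toLp_prod (hx.hasDerivAt_socCurve d 0) (hasDerivAt_const (0 : ℝ) (0 : SOCSpace m)))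
    (by simp [hx.socCurve_zero]) ?_
  filter_upwards [self_mem_nhdsWithin] with t ht
  exact socPair_zero_right_mem (socCurve_mem hx hd le_rfl (Set.mem_Ioi.1 ht).le)

lemma eventually_norm_snd_lt {ι : Type*} {l : Filter ι} {x : SOCSpace m}
    (hx : ‖x.snd‖ < x.fst) {x' : ι → SOCSpace m} (h : Tendsto x' l (𝓝 x)) :
    ∀ᶠ k in l, ‖(x' k).snd‖ < (x' k).fst :=
  ((tendsto_fst_snd h).2.norm).eventually_lt (tendsto_fst_snd h).1 hx

/-- First components close to `x` are interior too, which forces the second component to vanish. -/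
lemma bouligandTangentCone_interior {x : SOCSpace m} (hx : ‖x.snd‖ < x.fst) :
    bouligandTangentCone (socComplementaritySet m) (socPair x 0) ⊆ {q | q.snd = 0} := by
  rintro q ⟨t, q', ht, ht0, hq', hm⟩
  obtain ⟨h1, h2⟩ := tendsto_fst_snd hq'
  refine tendsto_nhds_unique h2 (tendsto_const_nhds.congr' ?_)
  filter_upwards [eventually_norm_snd_lt hx (tendsto_add_smul (z := x) ht0 h1)] with k hk
  have : (0 : SOCSpace m) + t k • (q' k).snd = 0 := eq_zero_of_norm_snd_lt (hm k) hk
  rw [zero_add, smul_eq_zero] at this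
  exact (this.resolve_left (ht k).ne').symm

lemma eventually_add_smul_mem {x : SOCSpace m} (hx : ‖x.snd‖ < x.fst) (d : SOCSpace m) :
    ∀ᶠ t in 𝓝[>] (0 : ℝ), ‖(x + t • d).snd‖ < (x + t • d).fst := by
  refine eventually_norm_snd_lt hx ?_
  have : Continuous fun t : ℝ => x + t • d := by fun_prop
  have := this.tendsto 0
  rw [zero_smul, add_zero] at this
  exact this.mono_left nhdsWithin_le_nhds

lemma tendsto_slope_socPair_line (x d : SOCSpace m) :
    Tendsto (fun t : ℝ => t⁻¹ • (socPair (x + t • d) 0 - socPair (x + (0 : ℝ) • d) 0)) (𝓝[>] 0)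
      (𝓝 (socPair d 0)) := by
  have : HasDerivAt (fun t : ℝ => x + t • d) d 0 := by
    simpa using ((hasDerivAt_id (0 : ℝ)).smul_const d).const_add x
  exact tendsto_slope_toLp_prod this (hasDerivAt_const (0 : ℝ) (0 : SOCSpace m))

lemma subset_innerTangentCone_interior {x : SOCSpace m} (hx : ‖x.snd‖ < x.fst) :
    {q | q.snd = 0} ⊆ innerTangentCone (socComplementaritySet m) (socPair x 0) := by
  intro q hq
  have hq' : q = socPair q.fst 0 := (WithLp.ofLp_injective 2) (Prod.ext rfl hq)
  rw [hq']
  refine mem_innerTangentCone_of_curve (socPair_zero_right_mem hx.le)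
    (tendsto_slope_socPair_line x q.fst) (by simp) ?_
  exact (eventually_add_smul_mem hx _).mono fun t ht => socPair_zero_right_mem ht.le

end SOCTangents

/-! ### Closed relations under limits, and a multiplier rule -/

section ClosedRelations

variable {H : Type*} [NormedAddCommGroup H] [InnerProductSpace ℝ H]

/-- Closed relations that hold between the points near `z` and their regular normals hold between
`z` and its limiting normals. -/
lemma mem_of_mem_limitingNormalCone {C : Set H} {z v : H} {S : Set (H × H)} (hS : IsClosed S)
    (h : ∀ᶠ z' in 𝓝 z, ∀ v' ∈ regularNormalCone C z', (z', v') ∈ S)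
    (hv : v ∈ limitingNormalCone C z) : (z, v) ∈ S := by
  obtain ⟨z', v', -, hz, hv, hm⟩ := hv
  refine hS.mem_of_tendsto (hz.prodMk_nhds hv) ?_
  filter_upwards [hz.eventually h] with k hk using hk _ (hm k)

lemma mem_of_mem_directionalNormalCone {C : Set H} {z d v : H} {S : Set (H × H)}
    (hS : IsClosed S)
    (h : ∀ᶠ q : ℝ × H in 𝓝[>] 0 ×ˢ 𝓝 d,
      ∀ v' ∈ regularNormalCone C (z + q.1 • q.2), (z + q.1 • q.2, v') ∈ S)
    (hv : v ∈ directionalNormalCone C z d) : (z, v) ∈ S := by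
  obtain ⟨t, d', v', ht, ht0, hd, hv, hm⟩ := hv
  refine hS.mem_of_tendsto ((tendsto_add_smul ht0 hd).prodMk_nhds hv) ?_
  filter_upwards [((tendsto_nhdsGT_zero ht ht0).prodMk hd).eventually h] with k hk
    using hk _ (hm k)

/-- Testing with the component of `q` orthogonal to `e` gives `‖q - r e‖² ≤ 0`. This supplies the
multiplier in the polar computations. -/
lemma eq_smul_of_forall_inner_nonpos {q e : H} (he : inner ℝ e e ≠ 0)
    (h : ∀ d, inner ℝ d e = 0 → inner ℝ q d ≤ 0) : ∃ r : ℝ, q = r • e := by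
  refine ⟨inner ℝ q e / inner ℝ e e, ?_⟩
  set r := inner ℝ q e / inner ℝ e e with hr
  have h1 : inner ℝ (q - r • e) e = 0 := by
    rw [inner_sub_left, inner_smul_left, hr, conj_trivial, div_mul_cancel₀ _ he, sub_self]
  have h2 := h _ h1
  have h3 : inner ℝ (q - r • e) (q - r • e) ≤ 0 := by
    rw [inner_sub_left, inner_smul_left, real_inner_comm _ e, h1]
    simpa using h2
  exact sub_eq_zero.1 (real_inner_self_nonpos.1 h3)

end ClosedRelations

/-! ### Regular normals, and normals along curves -/

section SOCNormals

variable {m : ℕ}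

open SOCSpace

lemma inner_pair (p q : WithLp 2 (SOCSpace m × SOCSpace m)) :
    inner ℝ p q = inner ℝ p.fst q.fst + inner ℝ p.snd q.snd :=
  WithLp.prod_inner_apply p q

lemma snd_mem_of_mem_bouligandTangentCone {x : SOCSpace m}
    {q : WithLp 2 (SOCSpace m × SOCSpace m)}
    (hq : q ∈ bouligandTangentCone (socComplementaritySet m) (socPair x 0)) :
    q.snd ∈ secondOrderCone m := by
  obtain ⟨t, q', ht, ht0, hq', hm⟩ := hq
  refine isClosed_secondOrderCone.mem_of_tendsto (tendsto_fst_snd hq').2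
    (Eventually.of_forall fun k => ?_)
  have h : (0 : SOCSpace m) + t k • (q' k).snd ∈ secondOrderCone m := (hm k).2.1
  rw [zero_add] at h
  simpa [smul_smul, inv_mul_cancel₀ (ht k).ne'] using
    smul_mem_secondOrderCone h (inv_nonneg.2 (ht k).le)

lemma socPair_fst_snd (q : WithLp 2 (SOCSpace m × SOCSpace m)) : socPair q.fst q.snd = q := rfl

namespace SOCSpace.IsBoundary

variable {x : SOCSpace m}

lemma mem_bouligandTangentCone_pair (hx : x.IsBoundary) {c : ℝ} (hc : 0 < c)
    {q : WithLp 2 (SOCSpace m × SOCSpace m)} :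
    q ∈ bouligandTangentCone (socComplementaritySet m) (socPair x (c • x.hat)) ↔
      inner ℝ q.fst x.hat = 0 ∧ ∃ s : ℝ, q.snd = c • q.fst.hat + s • x.hat := by
  refine ⟨fun hq => ⟨?_, _, snd_eq_of_mem_bouligandTangentCone hx.1 hq⟩, ?_⟩
  · exact inner_hat_eq_zero_of_mem_bouligandTangentCone hx hc.le hq fun h => absurd h hc.ne'
  · rintro ⟨h1, s, h2⟩
    have := mem_innerTangentCone_boundary hx hc.le h1 (s := s) fun h => absurd h hc.ne'
    rw [← h2] at this
    exact innerTangentCone_subset _ _ this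

lemma bouligandTangentCone_pair_subset (hx : x.IsBoundary) {c : ℝ} (hc : 0 < c) :
    bouligandTangentCone (socComplementaritySet m) (socPair x (c • x.hat)) ⊆
      innerTangentCone (socComplementaritySet m) (socPair x (c • x.hat)) := by
  intro q hq
  obtain ⟨h1, s, h2⟩ := (hx.mem_bouligandTangentCone_pair hc).1 hq
  have := mem_innerTangentCone_boundary hx hc.le h1 (s := s) fun h => absurd h hc.ne'
  rwa [← h2] at this

lemma mem_innerTangentCone_pair_zero (hx : x.IsBoundary)
    {q : WithLp 2 (SOCSpace m × SOCSpace m)}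
    (h : (0 ≤ inner ℝ q.fst x.hat ∧ q.snd = 0) ∨
      (inner ℝ q.fst x.hat = 0 ∧ ∃ s : ℝ, 0 ≤ s ∧ q.snd = s • x.hat)) :
    q ∈ innerTangentCone (socComplementaritySet m) (socPair x 0) := by
  rcases h with ⟨h1, h2⟩ | ⟨h1, s, hs, h2⟩
  · have := mem_innerTangentCone_right_zero hx h1
    rwa [show socPair q.fst 0 = q from congrArg (socPair q.fst) h2.symm] at this
  · have := mem_innerTangentCone_boundary hx le_rfl h1 (s := s) fun _ => hs
    rwa [zero_smul, zero_smul, zero_add, ← h2] at this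

lemma mem_bouligandTangentCone_pair_zero (hx : x.IsBoundary)
    {q : WithLp 2 (SOCSpace m × SOCSpace m)} :
    q ∈ bouligandTangentCone (socComplementaritySet m) (socPair x 0) ↔
      (0 ≤ inner ℝ q.fst x.hat ∧ q.snd = 0) ∨
        (inner ℝ q.fst x.hat = 0 ∧ ∃ s : ℝ, 0 ≤ s ∧ q.snd = s • x.hat) := by
  refine ⟨fun hq => ?_, fun h =>
    innerTangentCone_subset _ _ (hx.mem_innerTangentCone_pair_zero h)⟩
  have hd := fst_mem_of_mem_bouligandTangentCone hq
  have hw := snd_mem_of_mem_bouligandTangentCone hq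
  rw [hx.bouligandTangentCone_eq] at hd
  by_cases h0 : q.snd = 0
  · exact Or.inl ⟨hd, h0⟩
  · have hpos := fst_pos_of_mem_of_ne_zero hw h0
    -- Reads `(x, 0)` as `(x, c x̂)` with `c = 0`, so that the linearization applies.
    rw [← zero_smul ℝ x.hat] at hq
    refine Or.inr ⟨inner_hat_eq_zero_of_mem_bouligandTangentCone hx le_rfl hq fun _ => hpos.ne',
      q.snd.fst / x.fst, div_nonneg hpos.le hx.1.le, ?_⟩
    simpa using snd_eq_of_mem_bouligandTangentCone hx.1 hq

lemma inner_hat_hat_ne_zero (hx : x.IsBoundary) : inner ℝ x.hat x.hat ≠ 0 := by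
  rw [hx.inner_hat_hat]
  have := hx.1
  positivity

/-- The tangent cone is the linear space of all `(d, c d̂ + s x̂)` with `d ⊥ x̂`, on which `(u, v)`
takes the value `⟨u + c v̂, d⟩ + s ⟨v, x̂⟩`. Varying `s` gives `v ⊥ x̂`; varying `d` puts `u + c v̂`
on the line through `x̂`. -/
lemma mem_regularNormalCone_pair (hx : x.IsBoundary) {c : ℝ} (hc : 0 < c)
    {p : WithLp 2 (SOCSpace m × SOCSpace m)} :
    p ∈ regularNormalCone (socComplementaritySet m) (socPair x (c • x.hat)) ↔
      inner ℝ p.snd x.hat = 0 ∧ ∃ r : ℝ, p.fst = r • x.hat - c • p.snd.hat := by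
  rw [mem_regularNormalCone_iff]
  constructor
  · rintro ⟨-, h⟩
    have key : ∀ d : SOCSpace m, inner ℝ d x.hat = 0 → ∀ s : ℝ,
        inner ℝ (p.fst + c • p.snd.hat) d + s * inner ℝ p.snd x.hat ≤ 0 := fun d hd s => by
      have := h (socPair d (c • d.hat + s • x.hat))
        ((hx.mem_bouligandTangentCone_pair hc).2 ⟨hd, s, rfl⟩)
      rw [inner_pair] at this
      change inner ℝ p.fst d + inner ℝ p.snd (c • d.hat + s • x.hat) ≤ 0 at this
      rw [inner_add_right, inner_smul_right, inner_smul_right] at this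
      rw [inner_add_left, inner_smul_left, inner_hat_left, conj_trivial]
      linarith
    constructor
    · have h1 := key 0 (inner_zero_left _) 1
      have h2 := key 0 (inner_zero_left _) (-1)
      rw [inner_zero_right] at h1 h2
      linarith
    · obtain ⟨r, hr⟩ := eq_smul_of_forall_inner_nonpos hx.inner_hat_hat_ne_zero
        (q := p.fst + c • p.snd.hat) fun d hd => by
          have := key d hd 0
          rwa [zero_mul, add_zero] at this
      exact ⟨r, eq_sub_of_add_eq hr⟩
  · rintro ⟨h1, r, h2⟩
    refine ⟨hx.socPair_mem hc.le, fun q hq => ?_⟩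
    obtain ⟨h3, s, h4⟩ := (hx.mem_bouligandTangentCone_pair hc).1 hq
    rw [inner_pair, h2, h4, inner_sub_left, inner_add_right, inner_smul_left, inner_smul_left,
      inner_smul_right, inner_smul_right, inner_hat_left p.snd, real_inner_comm, h3, h1]
    simp only [conj_trivial]
    linarith

/-- The half-space part of the tangent cone confines `u` to the ray opposite to `x̂`; the tangent
`(0, x̂)` gives the sign condition on `v`. -/
lemma mem_regularNormalCone_pair_zero (hx : x.IsBoundary)
    {p : WithLp 2 (SOCSpace m × SOCSpace m)} :
    p ∈ regularNormalCone (socComplementaritySet m) (socPair x 0) ↔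
      (∃ s : ℝ, s ≤ 0 ∧ p.fst = s • x.hat) ∧ inner ℝ p.snd x.hat ≤ 0 := by
  rw [mem_regularNormalCone_iff]
  constructor
  · rintro ⟨-, h⟩
    have key : ∀ d : SOCSpace m, 0 ≤ inner ℝ d x.hat → inner ℝ p.fst d ≤ 0 := fun d hd => by
      have := h (socPair d 0) (hx.mem_bouligandTangentCone_pair_zero.2 (Or.inl ⟨hd, rfl⟩))
      rw [inner_pair] at this
      change inner ℝ p.fst d + inner ℝ p.snd 0 ≤ 0 at this
      rwa [inner_zero_right, add_zero] at this
    constructor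
    · obtain ⟨r, hr⟩ := eq_smul_of_forall_inner_nonpos hx.inner_hat_hat_ne_zero
        (q := p.fst) fun d hd => key d hd.ge
      refine ⟨r, ?_, hr⟩
      have := key x.hat real_inner_self_nonneg
      rw [hr, inner_smul_left, hx.inner_hat_hat, conj_trivial] at this
      have hx1 := hx.1
      exact nonpos_of_mul_nonpos_left this (by positivity)
    · have := h (socPair 0 x.hat) (hx.mem_bouligandTangentCone_pair_zero.2
        (Or.inr ⟨inner_zero_left _, 1, zero_le_one, (one_smul _ _).symm⟩))
      rw [inner_pair] at this
      change inner ℝ p.fst 0 + inner ℝ p.snd x.hat ≤ 0 at this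
      rwa [inner_zero_right, zero_add] at this
  · rintro ⟨⟨s, hs, h1⟩, h2⟩
    refine ⟨socPair_zero_right_mem hx.mem, fun q hq => ?_⟩
    rw [inner_pair, h1, inner_smul_left, conj_trivial, real_inner_comm]
    rcases hx.mem_bouligandTangentCone_pair_zero.1 hq with ⟨h3, h4⟩ | ⟨h3, r, hr, h4⟩
    · rw [h4, inner_zero_right, add_zero]
      exact mul_nonpos_of_nonpos_of_nonneg hs h3
    · rw [h3, h4, inner_smul_right, mul_zero, zero_add]
      exact mul_nonpos_of_nonneg_of_nonpos hr h2

end SOCSpace.IsBoundary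

lemma mem_regularNormalCone_interior {x : SOCSpace m} (hx : ‖x.snd‖ < x.fst)
    {p : WithLp 2 (SOCSpace m × SOCSpace m)} :
    p ∈ regularNormalCone (socComplementaritySet m) (socPair x 0) ↔ p.fst = 0 := by
  rw [mem_regularNormalCone_iff]
  constructor
  · rintro ⟨-, h⟩
    have := h (socPair p.fst 0) (innerTangentCone_subset _ _
      (subset_innerTangentCone_interior hx rfl))
    rw [inner_pair] at this
    change inner ℝ p.fst p.fst + inner ℝ p.snd 0 ≤ 0 at this
    rw [inner_zero_right, add_zero] at this
    exact real_inner_self_nonpos.1 this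
  · intro h
    refine ⟨socPair_zero_right_mem hx.le, fun q hq => ?_⟩
    have h2 : q.snd = 0 := bouligandTangentCone_interior hx hq
    rw [inner_pair, h, h2, inner_zero_left, inner_zero_right, add_zero]

lemma bouligandTangentCone_zero :
    bouligandTangentCone (socComplementaritySet m) (socPair 0 0) = socComplementaritySet m :=
  Set.Subset.antisymm
    (bouligandTangentCone_zero_of_cone smul_mem_socComplementaritySet
      isClosed_socComplementaritySet)
    ((subset_innerTangentCone_zero_of_cone smul_mem_socComplementaritySet).trans
      (innerTangentCone_subset _ _))

/-- `Ω` lies between `(K × {0}) ∪ ({0} × K)` and `K × K`, which have the same polar by self-duality.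
-/
lemma mem_regularNormalCone_zero {p : WithLp 2 (SOCSpace m × SOCSpace m)} :
    p ∈ regularNormalCone (socComplementaritySet m) (socPair 0 0) ↔
      -p.fst ∈ secondOrderCone m ∧ -p.snd ∈ secondOrderCone m := by
  rw [mem_regularNormalCone_iff, bouligandTangentCone_zero]
  constructor
  · rintro ⟨-, h⟩
    refine ⟨neg_mem_secondOrderCone_of_polar fun x hx => ?_,
      neg_mem_secondOrderCone_of_polar fun x hx => ?_⟩
    · have := h _ (socPair_zero_right_mem hx)
      rw [inner_pair] at this
      change inner ℝ p.fst x + inner ℝ p.snd 0 ≤ 0 at this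
      rwa [inner_zero_right, add_zero] at this
    · have := h _ (socPair_zero_left_mem hx)
      rw [inner_pair] at this
      change inner ℝ p.fst 0 + inner ℝ p.snd x ≤ 0 at this
      rwa [inner_zero_right, zero_add] at this
  · rintro ⟨h1, h2⟩
    refine ⟨socPair_zero_right_mem zero_mem_secondOrderCone, fun q hq => ?_⟩
    have h3 := inner_nonneg_of_mem_secondOrderCone h1 hq.1
    have h4 := inner_nonneg_of_mem_secondOrderCone h2 hq.2.1
    rw [inner_neg_left] at h3 h4
    rw [inner_pair]
    linarith

/-! Inner directional normals. -/

/-- The vector closest to `v` whose inner product with `x̂` is `κ`. -/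
noncomputable def innerCorrection (v x : SOCSpace m) (κ : ℝ) : SOCSpace m :=
  v - ((inner ℝ v x.hat - κ) / (2 * x.fst ^ 2)) • x.hat

lemma SOCSpace.IsBoundary.inner_innerCorrection {x : SOCSpace m} (hx : x.IsBoundary)
    (v : SOCSpace m) (κ : ℝ) : inner ℝ (innerCorrection v x κ) x.hat = κ := by
  have := hx.1.ne'
  rw [innerCorrection, inner_sub_left, inner_smul_left, hx.inner_hat_hat, conj_trivial]
  field_simp
  ring

/-- A fixed `v` need not keep its inner product with `x̂'` while `x'` moves along a curve. The
correction restores the value held at `x` and vanishes as `x' → x`. -/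
lemma tendsto_innerCorrection {ι : Type*} {l : Filter ι} {x' : ι → SOCSpace m} {x : SOCSpace m}
    (hx : x.IsBoundary) (h : Tendsto x' l (𝓝 x)) (v : SOCSpace m) :
    Tendsto (fun k => innerCorrection v (x' k) (inner ℝ v x.hat)) l (𝓝 v) := by
  have hh := (continuous_hat.tendsto x).comp h
  have h1 := (tendsto_fst_snd h).1
  have hne : 2 * x.fst ^ 2 ≠ 0 := by
    have := hx.1
    positivity
  have h2 : Tendsto (fun k => inner ℝ v (x' k).hat) l (𝓝 (inner ℝ v x.hat)) :=
    tendsto_const_nhds.inner hh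
  have := (((h2.sub_const (inner ℝ v x.hat)).div ((h1.pow 2).const_mul 2) hne).smul hh).const_sub v
  rw [sub_self, zero_div, zero_smul, sub_zero] at this
  exact this

lemma tendsto_pair {ι E F : Type*} [TopologicalSpace E] [TopologicalSpace F] {l : Filter ι}
    {f : ι → E} {g : ι → F} {p : WithLp 2 (E × F)} (hf : Tendsto f l (𝓝 p.fst))
    (hg : Tendsto g l (𝓝 p.snd)) : Tendsto (fun k => WithLp.toLp 2 (f k, g k)) l (𝓝 p) :=
  ((WithLp.prod_continuous_toLp 2 E F).tendsto (p.fst, p.snd)).comp (hf.prodMk_nhds hg)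

/-- Regular normals of nonzero pairs carried along `socPairCurve`. The value `c = 0` is allowed, so
this also produces normals at `(x, 0)`. -/
lemma mem_innerDirectionalNormalCone_boundary {x : SOCSpace m} (hx : x.IsBoundary) {c : ℝ}
    (hc : 0 ≤ c) {d : SOCSpace m} (hd : inner ℝ d x.hat = 0) {s : ℝ} (hs : c = 0 → 0 ≤ s)
    {p : WithLp 2 (SOCSpace m × SOCSpace m)} (hp : inner ℝ p.snd x.hat = 0) {r : ℝ}
    (hr : p.fst = r • x.hat - c • p.snd.hat) :
    p ∈ innerDirectionalNormalCone (socComplementaritySet m) (socPair x (c • x.hat))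
      (socPair d (c • d.hat + s • x.hat)) := by
  have hlim := tendsto_socCurve hx d 0
  have hv := tendsto_innerCorrection hx hlim p.snd
  have hcoef : Tendsto (fun t : ℝ => c + t * (s + t)) (𝓝[>] 0) (𝓝 c) := by
    have : Continuous fun t : ℝ => c + t * (s + t) := by fun_prop
    have := this.tendsto 0
    rw [zero_mul, add_zero] at this
    exact this.mono_left nhdsWithin_le_nhds
  refine mem_innerDirectionalNormalCone_of_curve (hx.socPair_mem hc)
    (hx.tendsto_slope_socPairCurve d c s) (hx.socPairCurve_zero d c s)
    (tendsto_pair (f := fun t => r • (socCurve x d 0 t).hat - (c + t * (s + t)) •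
      (innerCorrection p.snd (socCurve x d 0 t) (inner ℝ p.snd x.hat)).hat) ?_ hv) ?_
  · rw [hr]
    exact (((continuous_hat.tendsto x).comp hlim).const_smul r).sub
      (hcoef.smul ((continuous_hat.tendsto p.snd).comp hv))
  · filter_upwards [eventually_isBoundary_socCurve hx hd, eventually_coeff_pos hc hs] with t h1 h2
    refine (h1.mem_regularNormalCone_pair h2).2 ⟨?_, r, rfl⟩
    exact (h1.inner_innerCorrection _ _).trans hp

lemma mem_innerDirectionalNormalCone_of_fst_eq_zero {x : SOCSpace m} (hx : x.IsBoundary)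
    {d : SOCSpace m} (hd : 0 ≤ inner ℝ d x.hat)
    {p : WithLp 2 (SOCSpace m × SOCSpace m)} (hp : p.fst = 0) :
    p ∈ innerDirectionalNormalCone (socComplementaritySet m) (socPair x 0) (socPair d 0) := by
  -- Taking `a = 1` runs through the interior, where every `(0, v)` is normal, even if `d` is only
  -- tangent to the boundary.
  refine mem_innerDirectionalNormalCone_of_curve (γ := fun t => socPair (socCurve x d 1 t) 0)
    (socPair_zero_right_mem hx.mem)
    (tendsto_slope_toLp_prod (hx.hasDerivAt_socCurve d 1) (hasDerivAt_const (0 : ℝ)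
      (0 : SOCSpace m))) (by simp [hx.socCurve_zero]) tendsto_const_nhds ?_
  filter_upwards [self_mem_nhdsWithin] with t ht
  exact (mem_regularNormalCone_interior (norm_snd_socCurve_lt hx hd one_pos ht)).2 hp

lemma mem_innerDirectionalNormalCone_of_regular {x : SOCSpace m} (hx : x.IsBoundary)
    {d : SOCSpace m} (hd : inner ℝ d x.hat = 0) {p : WithLp 2 (SOCSpace m × SOCSpace m)}
    {s : ℝ} (hs : s ≤ 0) (hp : p.fst = s • x.hat) (hp2 : inner ℝ p.snd x.hat ≤ 0) :
    p ∈ innerDirectionalNormalCone (socComplementaritySet m) (socPair x 0) (socPair d 0) := by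
  have hlim := tendsto_socCurve hx d 0
  refine mem_innerDirectionalNormalCone_of_curve (γ := fun t => socPair (socCurve x d 0 t) 0)
    (socPair_zero_right_mem hx.mem)
    (tendsto_slope_toLp_prod (hx.hasDerivAt_socCurve d 0) (hasDerivAt_const (0 : ℝ)
      (0 : SOCSpace m))) (by simp [hx.socCurve_zero])
    (tendsto_pair (f := fun t => s • (socCurve x d 0 t).hat) ?_
      (tendsto_innerCorrection hx hlim p.snd)) ?_
  · rw [hp]
    exact ((continuous_hat.tendsto x).comp hlim).const_smul s
  · filter_upwards [eventually_isBoundary_socCurve hx hd] with t h1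
    exact h1.mem_regularNormalCone_pair_zero.2 ⟨⟨s, hs, rfl⟩,
      (h1.inner_innerCorrection _ _).trans_le hp2⟩

lemma mem_innerDirectionalNormalCone_interior {x : SOCSpace m} (hx : ‖x.snd‖ < x.fst)
    (d : SOCSpace m) {p : WithLp 2 (SOCSpace m × SOCSpace m)} (hp : p.fst = 0) :
    p ∈ innerDirectionalNormalCone (socComplementaritySet m) (socPair x 0) (socPair d 0) := by
  refine mem_innerDirectionalNormalCone_of_curve (socPair_zero_right_mem hx.le)
    (tendsto_slope_socPair_line x d) (by rw [zero_smul, add_zero]) tendsto_const_nhds ?_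
  exact (eventually_add_smul_mem hx d).mono fun t ht =>
    (mem_regularNormalCone_interior ht).2 hp

end SOCNormals

/-! ### Upper bounds for limiting and directional normals -/

section SOCLimitingNormals

variable {m : ℕ}

open SOCSpace

/-- A closed relation between pairs `(x, y)` of nonzero complementary vectors and their normals. -/
def pairNormalRelation (m : ℕ) :
    Set (WithLp 2 (SOCSpace m × SOCSpace m) × WithLp 2 (SOCSpace m × SOCSpace m)) :=
  {q | inner ℝ q.2.snd q.1.fst.hat = 0 ∧
    q.1.fst.fst • (q.1.fst.fst • q.2.fst + q.1.snd.fst • q.2.snd.hat) =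
      (q.1.fst.fst * q.2.fst.fst + q.1.snd.fst * q.2.snd.fst) • q.1.fst.hat}

/-- A closed relation between pairs `(x, 0)`, `x` on the boundary, and their regular normals. -/
def rayNormalRelation (m : ℕ) :
    Set (WithLp 2 (SOCSpace m × SOCSpace m) × WithLp 2 (SOCSpace m × SOCSpace m)) :=
  {q | q.1.fst.fst • q.2.fst = q.2.fst.fst • q.1.fst.hat ∧ q.2.fst.fst ≤ 0 ∧
    inner ℝ q.2.snd q.1.fst.hat ≤ 0}

lemma isClosed_pairNormalRelation : IsClosed (pairNormalRelation m) := by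
  simp only [pairNormalRelation, Set.ofPred_and]
  exact (isClosed_eq (by fun_prop) (by fun_prop)).inter (isClosed_eq (by fun_prop) (by fun_prop))

lemma isClosed_rayNormalRelation : IsClosed (rayNormalRelation m) := by
  simp only [rayNormalRelation, Set.ofPred_and]
  exact (isClosed_eq (by fun_prop) (by fun_prop)).inter
    ((isClosed_le (by fun_prop) (by fun_prop)).inter (isClosed_le (by fun_prop) (by fun_prop)))

lemma isClosed_fst_eq_zero : IsClosed {q : WithLp 2 (SOCSpace m × SOCSpace m) ×
    WithLp 2 (SOCSpace m × SOCSpace m) | q.2.fst = 0} :=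
  isClosed_eq (by fun_prop) (by fun_prop)

/-- In `u = r x̂ - c v̂` with `c = y₁ / x₁`, first coordinates give `x₁² r = x₁u₁ + y₁v₁`.
Eliminating `r` and clearing denominators leaves continuous equations that still make sense at `y =
0`. -/
lemma mem_pairNormalRelation_of_regular {z p : WithLp 2 (SOCSpace m × SOCSpace m)}
    (hp : p ∈ regularNormalCone (socComplementaritySet m) z) (hx : 0 < z.fst.fst)
    (hy : 0 < z.snd.fst) : (z, p) ∈ pairNormalRelation m := by
  have hb : z.fst.IsBoundary := isBoundary_of_mem hp.1 hx hy
  have hc : z.snd = (z.snd.fst / z.fst.fst) • z.fst.hat := eq_div_smul_hat_of_mem hp.1 hx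
  rw [← socPair_fst_snd z, hc] at hp
  obtain ⟨h1, r, h2⟩ := (hb.mem_regularNormalCone_pair (div_pos hy hx)).1 hp
  refine ⟨h1, ?_⟩
  have h3 := congrArg WithLp.fst h2
  simp only [WithLp.sub_fst, WithLp.smul_fst, hat_fst, smul_eq_mul] at h3
  have hx' := hx.ne'
  have h4 : z.fst.fst * p.fst.fst + z.snd.fst * p.snd.fst = z.fst.fst * (z.fst.fst * r) := by
    rw [h3]; field_simp; ring
  change z.fst.fst • (z.fst.fst • p.fst + z.snd.fst • p.snd.hat) =
    (z.fst.fst * p.fst.fst + z.snd.fst * p.snd.fst) • z.fst.hat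
  rw [h4, h2, smul_sub, smul_smul z.fst.fst (z.snd.fst / z.fst.fst),
    mul_div_cancel₀ _ hx', sub_add_cancel, smul_smul, smul_smul, mul_assoc]

lemma isBoundary_or_norm_snd_lt {x : SOCSpace m} (hx : x ∈ secondOrderCone m) (h : 0 < x.fst) :
    x.IsBoundary ∨ ‖x.snd‖ < x.fst := by
  rcases (show ‖x.snd‖ ≤ x.fst from hx).lt_or_eq with h' | h'
  exacts [Or.inr h', Or.inl ⟨h, h'⟩]

/-- With `x₁ > 0` there are three strata: `y ≠ 0`; `y = 0` with `x` on the boundary; `y = 0` with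
`x` interior. Each has its own closed relation, and the union of the three is closed. -/
lemma relation_of_regular {z p : WithLp 2 (SOCSpace m × SOCSpace m)}
    (hp : p ∈ regularNormalCone (socComplementaritySet m) z) (hx : 0 < z.fst.fst) :
    (z, p) ∈ pairNormalRelation m ∪ (rayNormalRelation m ∪ {q | q.2.fst = 0}) := by
  rcases (fst_nonneg_of_mem hp.1.2.1).lt_or_eq with hy | hy
  · exact Or.inl (mem_pairNormalRelation_of_regular hp hx hy)
  have hy0 := eq_zero_of_mem_of_fst_nonpos hp.1.2.1 hy.ge
  have hz := hp.1
  rw [← socPair_fst_snd z, hy0] at hp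
  rcases isBoundary_or_norm_snd_lt hz.1 hx with hb | hi
  · obtain ⟨⟨s, hs, h1⟩, h2⟩ := hb.mem_regularNormalCone_pair_zero.1 hp
    have h3 : p.fst.fst = s * z.fst.fst := by
      simpa using congrArg WithLp.fst h1
    refine Or.inr (Or.inl ⟨?_, ?_, h2⟩)
    · change z.fst.fst • p.fst = p.fst.fst • z.fst.hat
      rw [h3, h1, smul_smul, mul_comm]
    · change p.fst.fst ≤ 0
      rw [h3]
      exact mul_nonpos_of_nonpos_of_nonneg hs hx.le
  · exact Or.inr (Or.inr ((mem_regularNormalCone_interior hi).1 hp))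

lemma exists_of_mem_pairNormalRelation {x : SOCSpace m} (hx : 0 < x.fst) {c : ℝ}
    {p : WithLp 2 (SOCSpace m × SOCSpace m)}
    (h : (socPair x (c • x.hat), p) ∈ pairNormalRelation m) :
    inner ℝ p.snd x.hat = 0 ∧ ∃ r : ℝ, p.fst = r • x.hat - c • p.snd.hat := by
  obtain ⟨h1, h2⟩ := h
  refine ⟨h1, (x.fst * p.fst.fst + c * x.fst * p.snd.fst) / x.fst ^ 2, ?_⟩
  change x.fst • (x.fst • p.fst + (c * x.fst) • p.snd.hat) =
    (x.fst * p.fst.fst + c * x.fst * p.snd.fst) • x.hat at h2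
  have hx' := hx.ne'
  rw [div_eq_inv_mul, mul_smul, ← h2, eq_sub_iff_add_eq]
  have h3 : p.fst + c • p.snd.hat
      = (x.fst ^ 2)⁻¹ • x.fst ^ 2 • (p.fst + c • p.snd.hat) := by
    rw [smul_smul, inv_mul_cancel₀ (pow_ne_zero 2 hx'), one_smul]
  rw [h3]
  congr 1
  module

lemma eventually_fst_fst_pos {x y : SOCSpace m} (hx : 0 < x.fst) :
    ∀ᶠ z : WithLp 2 (SOCSpace m × SOCSpace m) in 𝓝 (socPair x y), 0 < z.fst.fst := by
  have : Continuous fun z : WithLp 2 (SOCSpace m × SOCSpace m) => z.fst.fst := by fun_prop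
  exact this.continuousAt.eventually_const_lt hx

lemma eventually_snd_fst_pos {x y : SOCSpace m} (hy : 0 < y.fst) :
    ∀ᶠ z : WithLp 2 (SOCSpace m × SOCSpace m) in 𝓝 (socPair x y), 0 < z.snd.fst := by
  have : Continuous fun z : WithLp 2 (SOCSpace m × SOCSpace m) => z.snd.fst := by fun_prop
  exact this.continuousAt.eventually_const_lt hy

lemma limitingNormalCone_interior_subset {x : SOCSpace m} (hx : ‖x.snd‖ < x.fst)
    {p : WithLp 2 (SOCSpace m × SOCSpace m)}
    (hp : p ∈ limitingNormalCone (socComplementaritySet m) (socPair x 0)) : p.fst = 0 := by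
  refine mem_of_mem_limitingNormalCone isClosed_fst_eq_zero ?_ hp
  filter_upwards [eventually_norm_snd_lt hx (tendsto_fst_snd tendsto_id).1] with z hz v hv
  have h0 : z.snd = 0 := eq_zero_of_norm_snd_lt hv.1 hz
  rw [← socPair_fst_snd z, h0] at hv
  exact (mem_regularNormalCone_interior hz).1 hv

namespace SOCSpace.IsBoundary

variable {x : SOCSpace m}

lemma limitingNormalCone_pair_subset (hx : x.IsBoundary) {c : ℝ} (hc : 0 < c)
    {p : WithLp 2 (SOCSpace m × SOCSpace m)}
    (hp : p ∈ limitingNormalCone (socComplementaritySet m) (socPair x (c • x.hat))) :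
    inner ℝ p.snd x.hat = 0 ∧ ∃ r : ℝ, p.fst = r • x.hat - c • p.snd.hat := by
  refine exists_of_mem_pairNormalRelation hx.1
    (mem_of_mem_limitingNormalCone isClosed_pairNormalRelation ?_ hp)
  filter_upwards [eventually_fst_fst_pos hx.1, eventually_snd_fst_pos (hx.hat.smul hc).1]
    with z h1 h2 v hv using mem_pairNormalRelation_of_regular hv h1 h2

lemma limitingNormalCone_pair_zero_subset (hx : x.IsBoundary)
    {p : WithLp 2 (SOCSpace m × SOCSpace m)}
    (hp : p ∈ limitingNormalCone (socComplementaritySet m) (socPair x 0)) :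
    p.fst = 0 ∨ ((∃ s : ℝ, p.fst = s • x.hat) ∧ inner ℝ p.snd x.hat = 0) ∨
      ((∃ s : ℝ, s ≤ 0 ∧ p.fst = s • x.hat) ∧ inner ℝ p.snd x.hat ≤ 0) := by
  have h := mem_of_mem_limitingNormalCone (isClosed_pairNormalRelation.union
    (isClosed_rayNormalRelation.union isClosed_fst_eq_zero))
    ((eventually_fst_fst_pos hx.1).mono fun z hz v hv => relation_of_regular hv hz) hp
  rcases h with h | ⟨h1, h2, h3⟩ | h
  · rw [← zero_smul ℝ x.hat] at h
    obtain ⟨h1, r, h2⟩ := exists_of_mem_pairNormalRelation hx.1 h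
    rw [zero_smul, sub_zero] at h2
    exact Or.inr (Or.inl ⟨⟨r, h2⟩, h1⟩)
  · refine Or.inr (Or.inr ⟨⟨p.fst.fst / x.fst,
      div_nonpos_of_nonpos_of_nonneg h2 hx.1.le, ?_⟩, h3⟩)
    change x.fst • p.fst = p.fst.fst • x.hat at h1
    rw [div_eq_inv_mul, mul_smul, ← h1, smul_smul, inv_mul_cancel₀ hx.1.ne', one_smul]
  · exact Or.inl h

end SOCSpace.IsBoundary

lemma tendsto_fst_add_smul (z δ : WithLp 2 (SOCSpace m × SOCSpace m)) :
    Tendsto (fun q : ℝ × WithLp 2 (SOCSpace m × SOCSpace m) => z + q.1 • q.2)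
      (𝓝[>] 0 ×ˢ 𝓝 δ) (𝓝 z) := by
  have : Continuous fun q : ℝ × WithLp 2 (SOCSpace m × SOCSpace m) => z + q.1 • q.2 := by
    fun_prop
  have := this.tendsto ((0 : ℝ), δ)
  rw [zero_smul, add_zero, nhds_prod_eq] at this
  exact this.mono_left (prod_mono_left _ nhdsWithin_le_nhds)

/-- Such a direction makes `y` nonzero along the sequence, so only normals of nonzero pairs
contribute. -/
lemma directionalNormalCone_pair_zero_subset {x : SOCSpace m} (hx : x.IsBoundary)
    {δ p : WithLp 2 (SOCSpace m × SOCSpace m)} (hδ : 0 < δ.snd.fst)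
    (hp : p ∈ directionalNormalCone (socComplementaritySet m) (socPair x 0) δ) :
    (∃ r : ℝ, p.fst = r • x.hat) ∧ inner ℝ p.snd x.hat = 0 := by
  have h := mem_of_mem_directionalNormalCone isClosed_pairNormalRelation ?_ hp
  · rw [← zero_smul ℝ x.hat] at h
    obtain ⟨h1, r, h2⟩ := exists_of_mem_pairNormalRelation hx.1 h
    rw [zero_smul, sub_zero] at h2
    exact ⟨⟨r, h2⟩, h1⟩
  · have h1 := (tendsto_fst_add_smul (socPair x 0) δ).eventually (eventually_fst_fst_pos hx.1)
    have h2 : ∀ᶠ q : ℝ × WithLp 2 (SOCSpace m × SOCSpace m) in 𝓝[>] 0 ×ˢ 𝓝 δ, 0 < q.1 :=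
      tendsto_fst.eventually self_mem_nhdsWithin
    have h3 : ∀ᶠ q : ℝ × WithLp 2 (SOCSpace m × SOCSpace m) in 𝓝[>] 0 ×ˢ 𝓝 δ,
        0 < q.2.snd.fst :=
      tendsto_snd.eventually (eventually_snd_fst_pos (x := δ.fst) (y := δ.snd) hδ)
    filter_upwards [h1, h2, h3] with q h1 h2 h3 v hv
    refine mem_pairNormalRelation_of_regular hv h1 ?_
    change 0 < (0 : ℝ) + q.1 * q.2.snd.fst
    rw [zero_add]
    exact mul_pos h2 h3

/-- Such a direction leads into the interior of the cone by `inner_add_smul_hat`, so only normals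
`(0, v)` contribute. -/
lemma directionalNormalCone_pair_zero_subset_of_pos {x : SOCSpace m} (hx : x.IsBoundary)
    {δ p : WithLp 2 (SOCSpace m × SOCSpace m)} (hδ : 0 < inner ℝ δ.fst x.hat)
    (hp : p ∈ directionalNormalCone (socComplementaritySet m) (socPair x 0) δ) :
    p.fst = 0 := by
  refine mem_of_mem_directionalNormalCone isClosed_fst_eq_zero ?_ hp
  have h1 := (tendsto_fst_add_smul (socPair x 0) δ).eventually (eventually_fst_fst_pos hx.1)
  have h2 : ∀ᶠ q : ℝ × WithLp 2 (SOCSpace m × SOCSpace m) in 𝓝[>] 0 ×ˢ 𝓝 δ, 0 < q.1 :=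
    tendsto_fst.eventually self_mem_nhdsWithin
  have h3 : ∀ᶠ q : ℝ × WithLp 2 (SOCSpace m × SOCSpace m) in 𝓝[>] 0 ×ˢ 𝓝 δ,
      0 < 2 * inner ℝ q.2.fst x.hat + q.1 * inner ℝ q.2.fst q.2.fst.hat := by
    have hc : Continuous fun q : ℝ × WithLp 2 (SOCSpace m × SOCSpace m) =>
        2 * inner ℝ q.2.fst x.hat + q.1 * inner ℝ q.2.fst q.2.fst.hat := by fun_prop
    have h0 := hc.tendsto ((0 : ℝ), δ)
    rw [zero_mul, add_zero, nhds_prod_eq] at h0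
    have h0 := h0.eventually_const_lt (mul_pos two_pos hδ)
    exact prod_mono_left _ nhdsWithin_le_nhds h0
  filter_upwards [h1, h2, h3] with q h1 h2 h3 v hv
  have hpos : 0 < inner ℝ (x + q.1 • q.2.fst) (x + q.1 • q.2.fst).hat := by
    rw [inner_add_smul_hat, hx.inner_hat_self, zero_add]
    exact mul_pos h2 h3
  have hlt : ‖(x + q.1 • q.2.fst).snd‖ < (x + q.1 • q.2.fst).fst := by
    change 0 < (x + q.1 • q.2.fst).fst at h1
    rw [inner_eq, hat_fst, hat_snd, inner_neg_right, real_inner_self_eq_norm_sq] at hpos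
    exact lt_of_pow_lt_pow_left₀ 2 h1.le (by linarith)
  rw [socPair_add_smul] at hv
  have h0 : (0 : SOCSpace m) + q.1 • q.2.snd = 0 := eq_zero_of_norm_snd_lt hv.1 hlt
  rw [h0] at hv
  exact (mem_regularNormalCone_interior hlt).1 hv

end SOCLimitingNormals

/-! ### The formulas, stratum by stratum -/

section SOCResults

variable {m : ℕ}

open SOCSpace

/-- The exchange of the two components. -/
noncomputable abbrev socSwap (m : ℕ) :
    WithLp 2 (SOCSpace m × SOCSpace m) ≃ₗᵢ[ℝ] WithLp 2 (SOCSpace m × SOCSpace m) :=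
  LinearIsometryEquiv.withLpProdComm 2 ℝ (SOCSpace m) (SOCSpace m)

lemma swap_mem_bouligandTangentCone_iff {z q : WithLp 2 (SOCSpace m × SOCSpace m)} :
    socSwap m q ∈ bouligandTangentCone (socComplementaritySet m) (socSwap m z) ↔
      q ∈ bouligandTangentCone (socComplementaritySet m) z :=
  ⟨map_mem_bouligandTangentCone (socSwap m) fun p => (swap_mem_socComplementaritySet p).2,
    map_mem_bouligandTangentCone (socSwap m) fun p => (swap_mem_socComplementaritySet p).2⟩

lemma swap_mem_innerTangentCone_iff {z q : WithLp 2 (SOCSpace m × SOCSpace m)} :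
    socSwap m q ∈ innerTangentCone (socComplementaritySet m) (socSwap m z) ↔
      q ∈ innerTangentCone (socComplementaritySet m) z :=
  ⟨map_mem_innerTangentCone (socSwap m) fun p => (swap_mem_socComplementaritySet p).2,
    map_mem_innerTangentCone (socSwap m) fun p => (swap_mem_socComplementaritySet p).2⟩

lemma swap_mem_regularNormalCone_iff {z q : WithLp 2 (SOCSpace m × SOCSpace m)} :
    socSwap m q ∈ regularNormalCone (socComplementaritySet m) (socSwap m z) ↔
      q ∈ regularNormalCone (socComplementaritySet m) z :=
  ⟨map_mem_regularNormalCone (socSwap m) swap_mem_socComplementaritySet,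
    map_mem_regularNormalCone (socSwap m) swap_mem_socComplementaritySet⟩

lemma swap_mem_limitingNormalCone_iff {z q : WithLp 2 (SOCSpace m × SOCSpace m)} :
    socSwap m q ∈ limitingNormalCone (socComplementaritySet m) (socSwap m z) ↔
      q ∈ limitingNormalCone (socComplementaritySet m) z :=
  ⟨map_mem_limitingNormalCone (socSwap m) swap_mem_socComplementaritySet,
    map_mem_limitingNormalCone (socSwap m) swap_mem_socComplementaritySet⟩

lemma swap_mem_directionalNormalCone_iff {z δ q : WithLp 2 (SOCSpace m × SOCSpace m)} :
    socSwap m q ∈ directionalNormalCone (socComplementaritySet m) (socSwap m z) (socSwap m δ) ↔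
      q ∈ directionalNormalCone (socComplementaritySet m) z δ :=
  ⟨map_mem_directionalNormalCone (socSwap m) swap_mem_socComplementaritySet,
    map_mem_directionalNormalCone (socSwap m) swap_mem_socComplementaritySet⟩

lemma swap_mem_innerDirectionalNormalCone_iff {z δ q : WithLp 2 (SOCSpace m × SOCSpace m)} :
    socSwap m q ∈
        innerDirectionalNormalCone (socComplementaritySet m) (socSwap m z) (socSwap m δ) ↔
      q ∈ innerDirectionalNormalCone (socComplementaritySet m) z δ :=
  ⟨map_mem_innerDirectionalNormalCone (socSwap m) swap_mem_socComplementaritySet,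
    map_mem_innerDirectionalNormalCone (socSwap m) swap_mem_socComplementaritySet⟩

lemma innerDirectional_subset_limiting {H : Type*} [NormedAddCommGroup H] [InnerProductSpace ℝ H]
    (C : Set H) (z d : H) : innerDirectionalNormalCone C z d ⊆ limitingNormalCone C z :=
  (innerDirectionalNormalCone_subset C z d).trans (directionalNormalCone_subset_limiting C z d)

/-! One component in the interior of the cone. -/

lemma bouligandTangentCone_interior_eq {x : SOCSpace m} (hx : ‖x.snd‖ < x.fst) :
    bouligandTangentCone (socComplementaritySet m) (socPair x 0) = {q | q.snd = 0} :=
  (bouligandTangentCone_interior hx).antisymm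
    ((subset_innerTangentCone_interior hx).trans (innerTangentCone_subset _ _))

lemma limitingNormalCone_interior_subset_inner {x : SOCSpace m} (hx : ‖x.snd‖ < x.fst)
    {δ : WithLp 2 (SOCSpace m × SOCSpace m)} (hδ : δ.snd = 0) :
    limitingNormalCone (socComplementaritySet m) (socPair x 0) ⊆
      innerDirectionalNormalCone (socComplementaritySet m) (socPair x 0) δ := by
  intro p hp
  have := mem_innerDirectionalNormalCone_interior hx δ.fst
    (limitingNormalCone_interior_subset hx hp)
  rwa [show socPair δ.fst 0 = δ from congrArg (socPair δ.fst) hδ.symm] at this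

lemma limitingNormalCone_interior_eq {x : SOCSpace m} (hx : ‖x.snd‖ < x.fst) :
    limitingNormalCone (socComplementaritySet m) (socPair x 0) = {p | p.fst = 0} :=
  Set.Subset.antisymm (fun _ hp => limitingNormalCone_interior_subset hx hp) fun _ hp =>
    innerDirectional_subset_limiting _ _ _ (mem_innerDirectionalNormalCone_interior hx 0 hp)

/-! Both components on the boundary of the cone. -/

namespace SOCSpace.IsBoundary

variable {x : SOCSpace m}

/-- This closes the chain of inclusions: inner directional, directional and limiting normals
coincide here for every tangent `δ`. -/
lemma limitingNormalCone_pair_subset_inner (hx : x.IsBoundary) {c : ℝ} (hc : 0 < c)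
    {δ : WithLp 2 (SOCSpace m × SOCSpace m)}
    (hδ : δ ∈ bouligandTangentCone (socComplementaritySet m) (socPair x (c • x.hat))) :
    limitingNormalCone (socComplementaritySet m) (socPair x (c • x.hat)) ⊆
      innerDirectionalNormalCone (socComplementaritySet m) (socPair x (c • x.hat)) δ := by
  intro p hp
  obtain ⟨h1, r, h2⟩ := hx.limitingNormalCone_pair_subset hc hp
  obtain ⟨h3, s, h4⟩ := (hx.mem_bouligandTangentCone_pair hc).1 hδ
  have := mem_innerDirectionalNormalCone_boundary hx hc.le h3 (s := s)
    (fun h => absurd h hc.ne') h1 h2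
  rwa [← h4] at this

lemma mem_limitingNormalCone_pair (hx : x.IsBoundary) {c : ℝ} (hc : 0 ≤ c)
    {p : WithLp 2 (SOCSpace m × SOCSpace m)} (h1 : inner ℝ p.snd x.hat = 0) {r : ℝ}
    (h2 : p.fst = r • x.hat - c • p.snd.hat) :
    p ∈ limitingNormalCone (socComplementaritySet m) (socPair x (c • x.hat)) :=
  innerDirectional_subset_limiting _ _ _ (mem_innerDirectionalNormalCone_boundary hx hc
    (inner_zero_left _) (s := 0) (fun _ => le_rfl) h1 h2)

lemma inner_hat_self_left (hx : x.IsBoundary) : inner ℝ x.hat x = 0 := by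
  rw [real_inner_comm, hx.inner_hat_self]

/-- Reflect the vector equation and divide by `x₁`. The condition `w ⊥ x` follows from the other
two, as `u ⊥ x` does in `normal_formula_iff`. -/
lemma tangent_formula_iff (hx : x.IsBoundary) {c : ℝ} (hc : 0 < c) {d w : SOCSpace m} :
    (inner ℝ d x.hat = 0 ∧ ∃ s : ℝ, w = c • d.hat + s • x.hat) ↔
      (∃ s : ℝ, x.fst • w.hat - (c • x.hat).fst • d = s • x) ∧
        inner ℝ d (c • x.hat) = 0 ∧ inner ℝ w x = 0 := by
  have hx' := hx.1.ne'
  constructor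
  · rintro ⟨h1, s, rfl⟩
    refine ⟨⟨x.fst * s, ?_⟩, by rw [inner_smul_right, h1, mul_zero], ?_⟩
    · simp only [hat_add, hat_smul, hat_hat, WithLp.smul_fst, hat_fst, smul_eq_mul]
      module
    · rw [inner_add_left, inner_smul_left, inner_smul_left, inner_hat_left, h1,
        hx.inner_hat_self_left, mul_zero, mul_zero, add_zero]
  · rintro ⟨⟨s, h1⟩, h2, -⟩
    rw [inner_smul_right] at h2
    refine ⟨(mul_eq_zero.1 h2).resolve_left hc.ne', s / x.fst, ?_⟩
    have h3 := congrArg SOCSpace.hat h1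
    simp only [hat_sub, hat_smul, hat_hat, WithLp.smul_fst, hat_fst, smul_eq_mul] at h3
    have h4 : x.fst • w = x.fst • (c • d.hat) + s • x.hat := by
      linear_combination (norm := module) h3
    have h5 := congrArg (fun y => x.fst⁻¹ • y) h4
    simp only [smul_add, inv_smul_smul₀ hx'] at h5
    rw [h5, smul_smul, div_eq_inv_mul]

lemma normal_formula_iff (hx : x.IsBoundary) {c : ℝ} (hc : 0 < c) {u v : SOCSpace m} :
    (inner ℝ v x.hat = 0 ∧ ∃ r : ℝ, u = r • x.hat - c • v.hat) ↔
      inner ℝ u x = 0 ∧ inner ℝ v (c • x.hat) = 0 ∧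
        ∃ s : ℝ, x.fst • u.hat + (c • x.hat).fst • v = s • x := by
  have hx' := hx.1.ne'
  constructor
  · rintro ⟨h1, r, rfl⟩
    refine ⟨?_, by rw [inner_smul_right, h1, mul_zero], x.fst * r, ?_⟩
    · rw [inner_sub_left, inner_smul_left, inner_smul_left, inner_hat_left, inner_hat_left, h1,
        ← inner_hat_left, hx.inner_hat_self_left, mul_zero, mul_zero, sub_zero]
    · simp only [hat_sub, hat_smul, hat_hat, WithLp.smul_fst, hat_fst, smul_eq_mul]
      module
  · rintro ⟨-, h2, s, h1⟩
    rw [inner_smul_right] at h2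
    refine ⟨(mul_eq_zero.1 h2).resolve_left hc.ne', s / x.fst, ?_⟩
    have h3 := congrArg SOCSpace.hat h1
    simp only [hat_add, hat_smul, hat_hat, WithLp.smul_fst, hat_fst, smul_eq_mul] at h3
    have h4 : x.fst • u = s • x.hat - x.fst • (c • v.hat) := by
      linear_combination (norm := module) h3
    have h5 := congrArg (fun y => x.fst⁻¹ • y) h4
    simp only [smul_sub, inv_smul_smul₀ hx'] at h5
    rw [h5, smul_smul, div_eq_inv_mul]

/-! One component on the boundary, the other zero. -/

lemma inner_of_pos (hx : x.IsBoundary) {d : SOCSpace m} (hd : 0 < inner ℝ d x.hat) :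
    directionalNormalCone (socComplementaritySet m) (socPair x 0) (socPair d 0) =
        {p | p.fst = 0} ∧
      {p | p.fst = 0} ⊆
        innerDirectionalNormalCone (socComplementaritySet m) (socPair x 0) (socPair d 0) := by
  have h : {p | p.fst = 0} ⊆
      innerDirectionalNormalCone (socComplementaritySet m) (socPair x 0) (socPair d 0) :=
    fun p hp => mem_innerDirectionalNormalCone_of_fst_eq_zero hx hd.le hp
  exact ⟨Set.Subset.antisymm
    (fun p hp => directionalNormalCone_pair_zero_subset_of_pos hx (δ := socPair d 0) hd hp)
    (h.trans (innerDirectionalNormalCone_subset _ _ _)), h⟩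

/-- Three curves share the velocity `(d, 0)`, one in each stratum meeting at `(x, 0)`, and each
produces one piece of the union. -/
lemma subset_inner_of_perp (hx : x.IsBoundary) {d : SOCSpace m} (hd : inner ℝ d x.hat = 0) :
    {p | p.fst = 0 ∨ ((∃ s : ℝ, p.fst = s • x.hat) ∧ inner ℝ p.snd x.hat = 0) ∨
      ((∃ s : ℝ, s ≤ 0 ∧ p.fst = s • x.hat) ∧ inner ℝ p.snd x.hat ≤ 0)} ⊆
      innerDirectionalNormalCone (socComplementaritySet m) (socPair x 0) (socPair d 0) := by
  rintro p (h | ⟨⟨s, h1⟩, h2⟩ | ⟨⟨s, hs, h1⟩, h2⟩)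
  · exact mem_innerDirectionalNormalCone_of_fst_eq_zero hx hd.ge h
  · have := mem_innerDirectionalNormalCone_boundary hx le_rfl hd (s := 0) (fun _ => le_rfl) h2
      (r := s) (by rw [h1, zero_smul, sub_zero])
    rwa [zero_smul, zero_smul, add_zero] at this
  · exact mem_innerDirectionalNormalCone_of_regular hx hd hs h1 h2

lemma limitingNormalCone_pair_zero_eq (hx : x.IsBoundary) :
    limitingNormalCone (socComplementaritySet m) (socPair x 0) =
      {p | p.fst = 0 ∨ ((∃ s : ℝ, p.fst = s • x.hat) ∧ inner ℝ p.snd x.hat = 0) ∨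
        ((∃ s : ℝ, s ≤ 0 ∧ p.fst = s • x.hat) ∧ inner ℝ p.snd x.hat ≤ 0)} :=
  Set.Subset.antisymm (fun _ hp => hx.limitingNormalCone_pair_zero_subset hp)
    ((hx.subset_inner_of_perp (d := 0) (inner_zero_left _)).trans
      (innerDirectional_subset_limiting _ _ _))

lemma limiting_subset_inner_of_perp (hx : x.IsBoundary) {d : SOCSpace m}
    (hd : inner ℝ d x.hat = 0) :
    limitingNormalCone (socComplementaritySet m) (socPair x 0) ⊆
      innerDirectionalNormalCone (socComplementaritySet m) (socPair x 0) (socPair d 0) := by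
  rw [hx.limitingNormalCone_pair_zero_eq]
  exact hx.subset_inner_of_perp hd

lemma directional_of_perp_pos (hx : x.IsBoundary) {d : SOCSpace m} (hd : inner ℝ d x.hat = 0)
    {s : ℝ} (hs : 0 < s) :
    directionalNormalCone (socComplementaritySet m) (socPair x 0) (socPair d (s • x.hat)) =
        {p | (∃ r : ℝ, p.fst = r • x.hat) ∧ inner ℝ p.snd x.hat = 0} ∧
      {p | (∃ r : ℝ, p.fst = r • x.hat) ∧ inner ℝ p.snd x.hat = 0} ⊆
        innerDirectionalNormalCone (socComplementaritySet m) (socPair x 0)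
          (socPair d (s • x.hat)) := by
  have h : {p | (∃ r : ℝ, p.fst = r • x.hat) ∧ inner ℝ p.snd x.hat = 0} ⊆
      innerDirectionalNormalCone (socComplementaritySet m) (socPair x 0)
        (socPair d (s • x.hat)) := by
    rintro p ⟨⟨r, h1⟩, h2⟩
    have := mem_innerDirectionalNormalCone_boundary hx le_rfl hd (s := s) (fun _ => hs.le) h2
      (r := r) (by rw [h1, zero_smul, sub_zero])
    rwa [zero_smul, zero_smul, zero_add] at this
  exact ⟨Set.Subset.antisymm
    (fun p hp => directionalNormalCone_pair_zero_subset hx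
      (δ := socPair d (s • x.hat)) (hx.hat.smul hs).1 hp)
    (h.trans (innerDirectionalNormalCone_subset _ _ _)), h⟩

end SOCSpace.IsBoundary

/-! Directional regularity and derivability of the tangent cone. -/

lemma exists_eq_smul_hat {x y : SOCSpace m} (h : socPair x y ∈ socComplementaritySet m)
    (hx : x ≠ 0) (hy : y ≠ 0) : x.IsBoundary ∧ ∃ c : ℝ, 0 < c ∧ y = c • x.hat := by
  have hx1 := fst_pos_of_mem_of_ne_zero h.1 hx
  have hy1 := fst_pos_of_mem_of_ne_zero h.2.1 hy
  exact ⟨isBoundary_of_mem h hx1 hy1, _, div_pos hy1 hx1, eq_div_smul_hat_of_mem h hx1⟩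

lemma directional_subset_inner_of_fst_ne_zero {x y : SOCSpace m}
    (h : socPair x y ∈ socComplementaritySet m) (hx : x ≠ 0)
    (δ : WithLp 2 (SOCSpace m × SOCSpace m)) :
    directionalNormalCone (socComplementaritySet m) (socPair x y) δ ⊆
      innerDirectionalNormalCone (socComplementaritySet m) (socPair x y) δ := by
  intro p hp
  have hδ := mem_bouligandTangentCone_of_mem_directionalNormalCone hp
  by_cases hy : y = 0
  · subst hy
    rcases isBoundary_or_norm_snd_lt h.1 (fst_pos_of_mem_of_ne_zero h.1 hx) with hb | hi
    · change x.IsBoundary at hb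
      rcases hb.mem_bouligandTangentCone_pair_zero.1 hδ with ⟨h1, h2⟩ | ⟨h1, s, hs, h2⟩
      · have hδ' : δ = socPair δ.fst 0 := congrArg (socPair δ.fst) h2
        rw [hδ'] at hp ⊢
        rcases h1.lt_or_eq with h1 | h1
        · rw [(hb.inner_of_pos h1).1] at hp
          exact (hb.inner_of_pos h1).2 hp
        · exact hb.limiting_subset_inner_of_perp h1.symm
            (directionalNormalCone_subset_limiting _ _ _ hp)
      · have hδ' : δ = socPair δ.fst (s • x.hat) := congrArg (socPair δ.fst) h2
        rw [hδ'] at hp ⊢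
        rcases hs.lt_or_eq with hs | rfl
        · rw [(hb.directional_of_perp_pos h1 hs).1] at hp
          exact (hb.directional_of_perp_pos h1 hs).2 hp
        · rw [zero_smul] at hp ⊢
          exact hb.limiting_subset_inner_of_perp h1
            (directionalNormalCone_subset_limiting _ _ _ hp)
    · change ‖x.snd‖ < x.fst at hi
      rw [bouligandTangentCone_interior_eq hi] at hδ
      exact limitingNormalCone_interior_subset_inner hi hδ
        (directionalNormalCone_subset_limiting _ _ _ hp)
  · obtain ⟨hb, c, hc, rfl⟩ := exists_eq_smul_hat h hx hy
    exact hb.limitingNormalCone_pair_subset_inner hc hδ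
      (directionalNormalCone_subset_limiting _ _ _ hp)

lemma directionallyRegular_socComplementaritySet :
    DirectionallyRegular (socComplementaritySet m) := by
  intro z hz δ
  refine Set.Subset.antisymm ?_ (innerDirectionalNormalCone_subset _ _ _)
  by_cases hx : z.fst = 0
  · by_cases hy : z.snd = 0
    · have h0 : z = 0 := (WithLp.ofLp_injective 2) (Prod.ext hx hy)
      subst h0
      exact (directionalNormalCone_zero_of_cone smul_mem_socComplementaritySet δ).trans
        (limitingNormalCone_subset_innerDirectional_zero_of_cone
          smul_mem_socComplementaritySet δ)
    · intro p hp
      exact swap_mem_innerDirectionalNormalCone_iff.1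
        (directional_subset_inner_of_fst_ne_zero (x := z.snd) (y := z.fst)
          ((swap_mem_socComplementaritySet z).2 hz) hy (socSwap m δ)
          (swap_mem_directionalNormalCone_iff.2 hp))
  · exact directional_subset_inner_of_fst_ne_zero (x := z.fst) (y := z.snd) hz hx δ

lemma bouligandTangentCone_subset_inner_of_fst_ne_zero {x y : SOCSpace m}
    (h : socPair x y ∈ socComplementaritySet m) (hx : x ≠ 0) :
    bouligandTangentCone (socComplementaritySet m) (socPair x y) ⊆
      innerTangentCone (socComplementaritySet m) (socPair x y) := by
  by_cases hy : y = 0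
  · subst hy
    rcases isBoundary_or_norm_snd_lt h.1 (fst_pos_of_mem_of_ne_zero h.1 hx) with hb | hi
    · change x.IsBoundary at hb
      exact fun q hq => hb.mem_innerTangentCone_pair_zero
        (hb.mem_bouligandTangentCone_pair_zero.1 hq)
    · exact (bouligandTangentCone_interior hi).trans (subset_innerTangentCone_interior hi)
  · obtain ⟨hb, c, hc, rfl⟩ := exists_eq_smul_hat h hx hy
    exact hb.bouligandTangentCone_pair_subset hc

lemma bouligandTangentCone_eq_innerTangentCone {x y : SOCSpace m}
    (h : socPair x y ∈ socComplementaritySet m) :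
    bouligandTangentCone (socComplementaritySet m) (socPair x y) =
      innerTangentCone (socComplementaritySet m) (socPair x y) := by
  refine Set.Subset.antisymm ?_ (innerTangentCone_subset _ _)
  by_cases hx : x = 0
  · by_cases hy : y = 0
    · subst hx hy
      rw [bouligandTangentCone_zero]
      exact subset_innerTangentCone_zero_of_cone smul_mem_socComplementaritySet
    · intro q hq
      exact swap_mem_innerTangentCone_iff.1
        (bouligandTangentCone_subset_inner_of_fst_ne_zero
          ((swap_mem_socComplementaritySet _).2 h) hy
          (swap_mem_bouligandTangentCone_iff.2 hq))
  · exact bouligandTangentCone_subset_inner_of_fst_ne_zero h hx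

/-! The limiting normal cone at the origin. -/

/-- Projection along a compact factor is a closed map. -/
lemma isClosed_setOf_exists_mem {X Y : Type*} [TopologicalSpace X] [TopologicalSpace Y]
    {K : Set Y} (hK : IsCompact K) {S : Set (X × Y)} (hS : IsClosed S) :
    IsClosed {x | ∃ y ∈ K, (x, y) ∈ S} := by
  have : CompactSpace K := isCompact_iff_compactSpace.1 hK
  have h := isClosedMap_fst_of_compactSpace (X := X) (Y := K) _
    (hS.preimage (f := fun q : X × K => (q.1, (q.2 : Y))) (by fun_prop))
  convert h using 1
  ext x
  constructor
  · rintro ⟨y, hy, hS⟩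
    exact ⟨(x, ⟨y, hy⟩), hS, rfl⟩
  · rintro ⟨⟨x', y⟩, hS, rfl⟩
    exact ⟨y, y.2, hS⟩

lemma isCompact_socBoundaryBase : IsCompact (socBoundaryBase m) := by
  refine Metric.isCompact_of_isClosed_isBounded ?_ ?_
  · simp only [socBoundaryBase, Set.ofPred_and]
    exact (isClosed_eq (by fun_prop) (by fun_prop)).inter
      (isClosed_eq (by fun_prop) (by fun_prop))
  · refine (Metric.isBounded_closedBall (x := (0 : SOCSpace m)) (r := 2)).subset ?_
    rintro ξ ⟨h1, h2⟩
    rw [mem_closedBall_zero_iff]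
    have h := WithLp.prod_norm_sq_eq_of_L2 ξ
    rw [h1, h2, norm_one] at h
    nlinarith [norm_nonneg ξ]

lemma isBoundary_of_mem_base {ξ : SOCSpace m} (h : ξ ∈ socBoundaryBase m) : ξ.IsBoundary :=
  ⟨by rw [h.1]; exact one_pos, h.2.trans h.1.symm⟩

lemma hat_mem_base {ξ : SOCSpace m} (h : ξ ∈ socBoundaryBase m) : ξ.hat ∈ socBoundaryBase m :=
  ⟨h.1, by rw [hat_snd, norm_neg]; exact h.2⟩

lemma SOCSpace.IsBoundary.inv_smul_mem_base {x : SOCSpace m} (hx : x.IsBoundary) :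
    x.fst⁻¹ • x ∈ socBoundaryBase m := by
  have h := hx.1.ne'
  refine ⟨by simp [h], ?_⟩
  have : x.fst⁻¹ * x.fst = 1 := inv_mul_cancel₀ h
  simpa [norm_smul, hx.2, abs_of_pos hx.1] using this

/-- The limiting normal cone of the complementarity set at the origin. -/
def socNormalsAtZero (m : ℕ) : Set (WithLp 2 (SOCSpace m × SOCSpace m)) :=
  {p | (-p.fst ∈ secondOrderCone m ∧ -p.snd ∈ secondOrderCone m) ∨
    p.snd = 0 ∨ p.fst = 0 ∨
    (∃ ξ ∈ socBoundaryBase m, (∃ s : ℝ, s ≤ 0 ∧ p.fst = s • ξ) ∧ inner ℝ p.snd ξ ≤ 0) ∨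
    (∃ ξ ∈ socBoundaryBase m, inner ℝ p.fst ξ ≤ 0 ∧ ∃ s : ℝ, s ≤ 0 ∧ p.snd = s • ξ) ∨
    (∃ ξ ∈ socBoundaryBase m, ∃ α : ℝ, 0 ≤ α ∧ α ≤ 1 ∧
      inner ℝ p.fst ξ = 0 ∧ inner ℝ p.snd ξ.hat = 0 ∧
      ∃ s : ℝ, α • p.fst.hat + (1 - α) • p.snd = s • ξ)}

/-- Since `ξ₁ = 1`, the multiplier is the first coordinate of `u`. This removes a quantifier over
the noncompact line before the compactness argument. -/
lemma exists_eq_smul_base_iff {ξ u : SOCSpace m} (hξ : ξ ∈ socBoundaryBase m) (P : ℝ → Prop) :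
    (∃ s : ℝ, P s ∧ u = s • ξ) ↔ P u.fst ∧ u = u.fst • ξ := by
  constructor
  · rintro ⟨s, hs, rfl⟩
    have : (s • ξ).fst = s := by simp [hξ.1]
    rw [this]
    exact ⟨hs, rfl⟩
  · rintro ⟨h1, h2⟩
    exact ⟨_, h1, h2⟩

lemma isClosed_rayNormals : IsClosed {p : WithLp 2 (SOCSpace m × SOCSpace m) |
    ∃ ξ ∈ socBoundaryBase m, (∃ s : ℝ, s ≤ 0 ∧ p.fst = s • ξ) ∧ inner ℝ p.snd ξ ≤ 0} := by
  have hS : IsClosed {q : WithLp 2 (SOCSpace m × SOCSpace m) × SOCSpace m |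
      (q.1.fst.fst ≤ 0 ∧ q.1.fst = q.1.fst.fst • q.2) ∧ inner ℝ q.1.snd q.2 ≤ 0} := by
    simp only [Set.ofPred_and]
    exact ((isClosed_le (by fun_prop) (by fun_prop)).inter
      (isClosed_eq (by fun_prop) (by fun_prop))).inter
      (isClosed_le (by fun_prop) (by fun_prop))
  convert isClosed_setOf_exists_mem isCompact_socBoundaryBase hS using 1
  ext p
  refine exists_congr fun ξ => and_congr_right fun hξ => ?_
  rw [exists_eq_smul_base_iff hξ (fun s => s ≤ 0)]
  rfl

lemma isClosed_pairNormals : IsClosed {p : WithLp 2 (SOCSpace m × SOCSpace m) |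
    ∃ ξ ∈ socBoundaryBase m, ∃ α : ℝ, 0 ≤ α ∧ α ≤ 1 ∧
      inner ℝ p.fst ξ = 0 ∧ inner ℝ p.snd ξ.hat = 0 ∧
      ∃ s : ℝ, α • p.fst.hat + (1 - α) • p.snd = s • ξ} := by
  have hS : IsClosed {q : WithLp 2 (SOCSpace m × SOCSpace m) × (SOCSpace m × ℝ) |
      inner ℝ q.1.fst q.2.1 = 0 ∧ inner ℝ q.1.snd q.2.1.hat = 0 ∧
      q.2.2 • q.1.fst.hat + (1 - q.2.2) • q.1.snd =
        (q.2.2 • q.1.fst.hat + (1 - q.2.2) • q.1.snd).fst • q.2.1} := by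
    simp only [Set.ofPred_and]
    exact (isClosed_eq (by fun_prop) (by fun_prop)).inter
      ((isClosed_eq (by fun_prop) (by fun_prop)).inter
        (isClosed_eq (by fun_prop) (by fun_prop)))
  convert isClosed_setOf_exists_mem (isCompact_socBoundaryBase.prod (isCompact_Icc (a := (0 : ℝ))
    (b := 1))) hS using 1
  ext p
  constructor
  · rintro ⟨ξ, hξ, α, h0, h1, h2, h3, h4⟩
    have := (exists_eq_smul_base_iff hξ (fun _ => True)).1 (by simpa using h4)
    exact ⟨(ξ, α), ⟨hξ, h0, h1⟩, h2, h3, this.2⟩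
  · rintro ⟨⟨ξ, α⟩, ⟨hξ, h0, h1⟩, h2, h3, h4⟩
    exact ⟨ξ, hξ, α, h0, h1, h2, h3, _, h4⟩

lemma isClosed_socNormalsAtZero : IsClosed (socNormalsAtZero m) := by
  have h1 : IsClosed {p : WithLp 2 (SOCSpace m × SOCSpace m) |
      -p.fst ∈ secondOrderCone m ∧ -p.snd ∈ secondOrderCone m} :=
    (isClosed_secondOrderCone.preimage (f := fun p : WithLp 2 (SOCSpace m × SOCSpace m) => -p.fst)
      (by fun_prop)).inter (isClosed_secondOrderCone.preimage
        (f := fun p : WithLp 2 (SOCSpace m × SOCSpace m) => -p.snd) (by fun_prop))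
  have h2 : IsClosed {p : WithLp 2 (SOCSpace m × SOCSpace m) | p.snd = 0} :=
    isClosed_eq (by fun_prop) (by fun_prop)
  have h3 : IsClosed {p : WithLp 2 (SOCSpace m × SOCSpace m) | p.fst = 0} :=
    isClosed_eq (by fun_prop) (by fun_prop)
  have h5 : IsClosed {p : WithLp 2 (SOCSpace m × SOCSpace m) | ∃ ξ ∈ socBoundaryBase m,
      inner ℝ p.fst ξ ≤ 0 ∧ ∃ s : ℝ, s ≤ 0 ∧ p.snd = s • ξ} := by
    refine (congrArg IsClosed (Set.ext fun p => ?_)).mpr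
      (isClosed_rayNormals.preimage (socSwap m).continuous)
    constructor <;> rintro ⟨ξ, hξ, h, h'⟩ <;> exact ⟨ξ, hξ, h', h⟩
  exact h1.union (h2.union (h3.union (isClosed_rayNormals.union
    (h5.union isClosed_pairNormals))))

lemma regularNormalCone_right_zero {x : SOCSpace m} (hx : x ≠ 0)
    {p : WithLp 2 (SOCSpace m × SOCSpace m)}
    (hp : p ∈ regularNormalCone (socComplementaritySet m) (socPair x 0)) :
    p.fst = 0 ∨ ∃ ξ ∈ socBoundaryBase m,
      (∃ s : ℝ, s ≤ 0 ∧ p.fst = s • ξ) ∧ inner ℝ p.snd ξ ≤ 0 := by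
  have hxK : x ∈ secondOrderCone m := hp.1.1
  have hx1 := fst_pos_of_mem_of_ne_zero hxK hx
  rcases isBoundary_or_norm_snd_lt hxK hx1 with hb | hi
  · obtain ⟨⟨s, hs, h1⟩, h2⟩ := hb.mem_regularNormalCone_pair_zero.1 hp
    refine Or.inr ⟨_, hb.hat.inv_smul_mem_base, ⟨s * x.fst,
      mul_nonpos_of_nonpos_of_nonneg hs hx1.le, ?_⟩, ?_⟩
    · rw [h1, hat_fst, smul_smul, mul_assoc, mul_inv_cancel₀ hx1.ne', mul_one]
    · rw [inner_smul_right, hat_fst]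
      exact mul_nonpos_of_nonneg_of_nonpos (inv_nonneg.2 hx1.le) h2
  · exact Or.inl ((mem_regularNormalCone_interior hi).1 hp)

lemma regularNormalCone_subset_socNormalsAtZero (z : WithLp 2 (SOCSpace m × SOCSpace m)) :
    regularNormalCone (socComplementaritySet m) z ⊆ socNormalsAtZero m := by
  intro p hp
  by_cases hx : z.fst = 0
  · by_cases hy : z.snd = 0
    · have h0 : z = socPair 0 0 := (WithLp.ofLp_injective 2) (Prod.ext hx hy)
      rw [h0] at hp
      exact Or.inl (mem_regularNormalCone_zero.1 hp)
    · have hp' := swap_mem_regularNormalCone_iff.2 hp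
      have hz : socSwap m z = socPair z.snd 0 := congrArg (socPair z.snd) hx
      rw [hz] at hp'
      rcases regularNormalCone_right_zero hy hp' with h | ⟨ξ, hξ, h1, h2⟩
      · exact Or.inr (Or.inl h)
      · exact Or.inr (Or.inr (Or.inr (Or.inr (Or.inl ⟨ξ, hξ, h2, h1⟩))))
  · by_cases hy : z.snd = 0
    · have hz : z = socPair z.fst 0 := congrArg (socPair z.fst) hy
      rw [hz] at hp
      rcases regularNormalCone_right_zero hx hp with h | h
      · exact Or.inr (Or.inr (Or.inl h))
      · exact Or.inr (Or.inr (Or.inr (Or.inl h)))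
    · obtain ⟨hb, c, hc, h⟩ := exists_eq_smul_hat (x := z.fst) (y := z.snd) hp.1 hx hy
      have hz : z = socPair z.fst (c • z.fst.hat) := congrArg (socPair z.fst) h
      rw [hz] at hp
      have hn := (hb.mem_regularNormalCone_pair hc).1 hp
      obtain ⟨h1, -, -⟩ := (hb.normal_formula_iff hc).1 hn
      obtain ⟨h2, r, h3⟩ := hn
      have hx1 := hb.1.ne'
      have hc1 : 1 + c ≠ 0 := by positivity
      -- The reflected normal equation is `û + c v = r x`; dividing by `1 + c` makes the weights `α`
      -- and `1 - α`.
      refine Or.inr (Or.inr (Or.inr (Or.inr (Or.inr ⟨_, hb.inv_smul_mem_base, 1 / (1 + c),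
        by positivity, ?_, ?_, ?_, r / (1 + c) * z.fst.fst, ?_⟩))))
      · rw [div_le_one (by positivity)]
        linarith
      · rw [inner_smul_right, h1, mul_zero]
      · rw [hat_smul, inner_smul_right, h2, mul_zero]
      · rw [h3, smul_smul, mul_assoc, mul_inv_cancel₀ hx1]
        simp only [hat_sub, hat_smul, hat_hat]
        have : 1 - 1 / (1 + c) = 1 / (1 + c) * c := by field_simp; ring
        rw [this]
        module

/-- All regular normals of `Ω` lie in one closed set, which bounds the limiting cone. Conversely,
limiting normals at any point are limiting normals at the origin because `Ω` is a cone, so each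
piece is realized at a suitable nonzero point or at the origin itself. -/
lemma limitingNormalCone_zero_eq :
    limitingNormalCone (socComplementaritySet m) (socPair 0 0) = socNormalsAtZero m := by
  refine Set.Subset.antisymm ?_ ?_
  · rintro p ⟨z', v', -, -, hv, hm⟩
    exact isClosed_socNormalsAtZero.mem_of_tendsto hv
      (Eventually.of_forall fun k => regularNormalCone_subset_socNormalsAtZero _ (hm k))
  · have hcone := fun z => limitingNormalCone_subset_zero_of_cone
      (smul_mem_socComplementaritySet (m := m)) z
    have hfst : ∀ p : WithLp 2 (SOCSpace m × SOCSpace m), p.fst = 0 →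
        p ∈ limitingNormalCone (socComplementaritySet m) (socPair 0 0) := fun p h => by
      have h1 : ‖(WithLp.toLp 2 (1, 0) : SOCSpace m).snd‖ <
          (WithLp.toLp 2 (1, 0) : SOCSpace m).fst := by simp
      refine hcone (socPair (WithLp.toLp 2 (1, 0)) 0) ?_
      rw [limitingNormalCone_interior_eq h1]
      exact h
    have hray : ∀ (p : WithLp 2 (SOCSpace m × SOCSpace m)), ∀ ξ ∈ socBoundaryBase m,
        (∃ s : ℝ, s ≤ 0 ∧ p.fst = s • ξ) ∧ inner ℝ p.snd ξ ≤ 0 →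
        p ∈ limitingNormalCone (socComplementaritySet m) (socPair 0 0) := fun p ξ hξ h => by
      refine hcone (socPair ξ.hat 0) ?_
      rw [(isBoundary_of_mem_base (hat_mem_base hξ)).limitingNormalCone_pair_zero_eq]
      refine Or.inr (Or.inr ?_)
      rwa [hat_hat]
    rintro p (h | h | h | ⟨ξ, hξ, h⟩ | ⟨ξ, hξ, h1, h2⟩ | ⟨ξ, hξ, α, h0, h1, h2, h3, s, h4⟩)
    · exact regularNormalCone_subset_limiting _ _ (mem_regularNormalCone_zero.2 h)
    · exact swap_mem_limitingNormalCone_iff.1 (hfst (socSwap m p) h)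
    · exact hfst p h
    · exact hray p ξ hξ h
    · exact swap_mem_limitingNormalCone_iff.1 (hray (socSwap m p) ξ hξ ⟨h2, h1⟩)
    · have hb := isBoundary_of_mem_base hξ
      rcases h0.eq_or_lt with rfl | h0
      -- The value `α = 0` corresponds to `c = ∞`, so the normal is found at `(0, ξ̂)`.
      · refine swap_mem_limitingNormalCone_iff.1 (hcone (socPair ξ.hat 0) ?_)
        rw [hb.hat.limitingNormalCone_pair_zero_eq, hat_hat]
        refine Or.inr (Or.inl ⟨⟨s, ?_⟩, h2⟩)
        simpa using h4
      · have hα := h0.ne'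
        -- This `c` inverts `α = 1 / (1 + c)`; it may be zero, when `α = 1`.
        refine hcone _ (hb.mem_limitingNormalCone_pair (c := (1 - α) / α)
          (div_nonneg (by linarith) h0.le) h3 (r := s / α) ?_)
        have h5 := congrArg SOCSpace.hat h4
        simp only [hat_add, hat_smul, hat_hat] at h5
        have h6 : α • p.fst = s • ξ.hat - (1 - α) • p.snd.hat := eq_sub_of_add_eq h5
        have h7 := congrArg (fun y => α⁻¹ • y) h6
        simp only [smul_sub, inv_smul_smul₀ hα] at h7
        rw [h7, smul_smul, smul_smul, div_eq_inv_mul, div_eq_inv_mul]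

end SOCResults

/-! ### Interior and boundary of the tangent half-space -/

section SOCFrontier

variable {m : ℕ} {x d : SOCSpace m}

lemma SOCSpace.IsBoundary.inner_pos_of_mem_interior (hx : x.IsBoundary)
    (hd : d ∈ interior (bouligandTangentCone (secondOrderCone m) x)) :
    0 < inner ℝ d x.hat := by
  rw [hx.bouligandTangentCone_eq] at hd
  obtain ⟨t, ht, h⟩ := exists_pos_sub_smul_mem hd x.hat
  have h' : 0 ≤ inner ℝ (d - t • x.hat) x.hat := h
  rw [inner_sub_left, inner_smul_left, hx.inner_hat_hat, conj_trivial] at h'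
  have := hx.1
  have : 0 < t * (2 * x.fst ^ 2) := by positivity
  linarith

lemma SOCSpace.IsBoundary.inner_eq_zero_of_mem_frontier (hx : x.IsBoundary)
    (hd : d ∈ frontier (bouligandTangentCone (secondOrderCone m) x)) :
    inner ℝ d x.hat = 0 := by
  rw [hx.bouligandTangentCone_eq] at hd
  exact (frontier_le_subset_eq (f := fun _ : SOCSpace m => (0 : ℝ))
    (g := fun d : SOCSpace m => inner ℝ d x.hat) (by fun_prop) (by fun_prop) hd).symm

end SOCFrontier

/-! ### Assembly of the theorem -/

theorem mainTheorem1 (m : ℕ) (hm : 1 ≤ m) :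
    -- directional regularity
    DirectionallyRegular (socComplementaritySet m) ∧
    ∀ x y : SOCSpace m, socPair x y ∈ socComplementaritySet m →
      -- the tangent cone and the inner tangent cone agree
      bouligandTangentCone (socComplementaritySet m) (socPair x y) =
        innerTangentCone (socComplementaritySet m) (socPair x y) ∧
      -- Case 1: tangent cone, normal cone, directional normal cones
      (x = 0 → y ∈ interior (secondOrderCone m) →
        bouligandTangentCone (socComplementaritySet m) (socPair x y) = {q | q.fst = 0} ∧
        limitingNormalCone (socComplementaritySet m) (socPair x y) = {p | p.snd = 0} ∧
        ∀ d w : SOCSpace m,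
          socPair d w ∈ bouligandTangentCone (socComplementaritySet m) (socPair x y) →
          directionalNormalCone (socComplementaritySet m) (socPair x y) (socPair d w) =
            limitingNormalCone (socComplementaritySet m) (socPair x y)) ∧
      -- Case 2
      (x ∈ interior (secondOrderCone m) → y = 0 →
        bouligandTangentCone (socComplementaritySet m) (socPair x y) = {q | q.snd = 0} ∧
        limitingNormalCone (socComplementaritySet m) (socPair x y) = {p | p.fst = 0} ∧
        ∀ d w : SOCSpace m,
          socPair d w ∈ bouligandTangentCone (socComplementaritySet m) (socPair x y) →
          directionalNormalCone (socComplementaritySet m) (socPair x y) (socPair d w) =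
            limitingNormalCone (socComplementaritySet m) (socPair x y)) ∧
      -- Case 3
      (x ∈ frontier (secondOrderCone m) \ {0} → y ∈ frontier (secondOrderCone m) \ {0} →
        bouligandTangentCone (socComplementaritySet m) (socPair x y) =
          {q | (∃ s : ℝ, x.fst • q.snd.hat - y.fst • q.fst = s • x) ∧
            inner ℝ q.fst y = 0 ∧ inner ℝ q.snd x = 0} ∧
        limitingNormalCone (socComplementaritySet m) (socPair x y) =
          {p | inner ℝ p.fst x = 0 ∧ inner ℝ p.snd y = 0 ∧
            ∃ s : ℝ, x.fst • p.fst.hat + y.fst • p.snd = s • x} ∧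
        ∀ d w : SOCSpace m,
          socPair d w ∈ bouligandTangentCone (socComplementaritySet m) (socPair x y) →
          directionalNormalCone (socComplementaritySet m) (socPair x y) (socPair d w) =
            limitingNormalCone (socComplementaritySet m) (socPair x y)) ∧
      -- Case 4
      (x ∈ frontier (secondOrderCone m) \ {0} → y = 0 →
        bouligandTangentCone (socComplementaritySet m) (socPair x y) =
          {q | (q.fst ∈ bouligandTangentCone (secondOrderCone m) x ∧ q.snd = 0) ∨
            (inner ℝ q.fst x.hat = 0 ∧ ∃ s : ℝ, 0 ≤ s ∧ q.snd = s • x.hat)} ∧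
        limitingNormalCone (socComplementaritySet m) (socPair x y) =
          {p | p.fst = 0 ∨
            ((∃ s : ℝ, p.fst = s • x.hat) ∧ inner ℝ p.snd x.hat = 0) ∨
            ((∃ s : ℝ, s ≤ 0 ∧ p.fst = s • x.hat) ∧ inner ℝ p.snd x.hat ≤ 0)} ∧
        ∀ d w : SOCSpace m,
          socPair d w ∈ bouligandTangentCone (socComplementaritySet m) (socPair x y) →
          (d ∈ interior (bouligandTangentCone (secondOrderCone m) x) → w = 0 →
            directionalNormalCone (socComplementaritySet m) (socPair x y) (socPair d w) =
              {p | p.fst = 0}) ∧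
          (d ∈ frontier (bouligandTangentCone (secondOrderCone m) x) → w = 0 →
            directionalNormalCone (socComplementaritySet m) (socPair x y) (socPair d w) =
              limitingNormalCone (socComplementaritySet m) (socPair x y)) ∧
          (inner ℝ d x.hat = 0 → (∃ s : ℝ, 0 ≤ s ∧ w = s • x.hat) → w ≠ 0 →
            directionalNormalCone (socComplementaritySet m) (socPair x y) (socPair d w) =
              {p | (∃ s : ℝ, p.fst = s • x.hat) ∧ inner ℝ p.snd x.hat = 0})) ∧
      -- Case 5
      (x = 0 → y ∈ frontier (secondOrderCone m) \ {0} →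
        bouligandTangentCone (socComplementaritySet m) (socPair x y) =
          {q | (q.fst = 0 ∧ q.snd ∈ bouligandTangentCone (secondOrderCone m) y) ∨
            ((∃ s : ℝ, 0 ≤ s ∧ q.fst = s • y.hat) ∧ inner ℝ q.snd y.hat = 0)} ∧
        limitingNormalCone (socComplementaritySet m) (socPair x y) =
          {p | p.snd = 0 ∨
            (inner ℝ p.fst y.hat = 0 ∧ ∃ s : ℝ, p.snd = s • y.hat) ∨
            (inner ℝ p.fst y.hat ≤ 0 ∧ ∃ s : ℝ, s ≤ 0 ∧ p.snd = s • y.hat)} ∧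
        ∀ d w : SOCSpace m,
          socPair d w ∈ bouligandTangentCone (socComplementaritySet m) (socPair x y) →
          (d = 0 → w ∈ interior (bouligandTangentCone (secondOrderCone m) y) →
            directionalNormalCone (socComplementaritySet m) (socPair x y) (socPair d w) =
              {p | p.snd = 0}) ∧
          (d = 0 → w ∈ frontier (bouligandTangentCone (secondOrderCone m) y) →
            directionalNormalCone (socComplementaritySet m) (socPair x y) (socPair d w) =
              limitingNormalCone (socComplementaritySet m) (socPair x y)) ∧
          ((∃ s : ℝ, 0 ≤ s ∧ d = s • y.hat) → d ≠ 0 → inner ℝ w y.hat = 0 →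
            directionalNormalCone (socComplementaritySet m) (socPair x y) (socPair d w) =
              {p | inner ℝ p.fst y.hat = 0 ∧ ∃ s : ℝ, p.snd = s • y.hat})) ∧
      -- Case 6
      (x = 0 → y = 0 →
        bouligandTangentCone (socComplementaritySet m) (socPair x y) =
          {q | q.fst ∈ secondOrderCone m ∧ q.snd ∈ secondOrderCone m ∧
            inner ℝ q.fst q.snd = 0} ∧
        limitingNormalCone (socComplementaritySet m) (socPair x y) =
          {p | (-p.fst ∈ secondOrderCone m ∧ -p.snd ∈ secondOrderCone m) ∨
            p.snd = 0 ∨ p.fst = 0 ∨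
            (∃ ξ ∈ socBoundaryBase m,
              (∃ s : ℝ, s ≤ 0 ∧ p.fst = s • ξ) ∧ inner ℝ p.snd ξ ≤ 0) ∨
            (∃ ξ ∈ socBoundaryBase m,
              inner ℝ p.fst ξ ≤ 0 ∧ ∃ s : ℝ, s ≤ 0 ∧ p.snd = s • ξ) ∨
            (∃ ξ ∈ socBoundaryBase m, ∃ α : ℝ, 0 ≤ α ∧ α ≤ 1 ∧
              inner ℝ p.fst ξ = 0 ∧ inner ℝ p.snd ξ.hat = 0 ∧
              ∃ s : ℝ, α • p.fst.hat + (1 - α) • p.snd = s • ξ)} ∧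
        ∀ d w : SOCSpace m,
          socPair d w ∈ bouligandTangentCone (socComplementaritySet m) (socPair x y) →
          directionalNormalCone (socComplementaritySet m) (socPair x y) (socPair d w) =
            limitingNormalCone (socComplementaritySet m) (socPair d w)) := by
  refine ⟨directionallyRegular_socComplementaritySet, fun x y hxy =>
    ⟨bouligandTangentCone_eq_innerTangentCone hxy, ?_, ?_, ?_, ?_, ?_, ?_⟩⟩
  · rintro rfl hy
    have hi := norm_snd_lt_of_mem_interior hy
    -- The mirror image, under exchange of components, of the case `y = 0` with `x` interior.
    have hT : bouligandTangentCone (socComplementaritySet m) (socPair 0 y) =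
        {q | q.fst = 0} := by
      ext q
      rw [← swap_mem_bouligandTangentCone_iff]
      exact Set.ext_iff.1 (bouligandTangentCone_interior_eq hi) (socSwap m q)
    refine ⟨hT, ?_, fun d w hdw => ?_⟩
    · ext p
      rw [← swap_mem_limitingNormalCone_iff]
      exact Set.ext_iff.1 (limitingNormalCone_interior_eq hi) (socSwap m p)
    · refine (directionalNormalCone_subset_limiting _ _ _).antisymm fun p hp => ?_
      rw [← swap_mem_limitingNormalCone_iff] at hp
      rw [hT] at hdw
      exact innerDirectionalNormalCone_subset _ _ _ (swap_mem_innerDirectionalNormalCone_iff.1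
        (limitingNormalCone_interior_subset_inner hi (δ := socPair w d) hdw hp))
  · rintro hx rfl
    have hi := norm_snd_lt_of_mem_interior hx
    refine ⟨bouligandTangentCone_interior_eq hi, limitingNormalCone_interior_eq hi,
      fun d w hdw => ?_⟩
    rw [bouligandTangentCone_interior_eq hi] at hdw
    exact (directionalNormalCone_subset_limiting _ _ _).antisymm
      ((limitingNormalCone_interior_subset_inner hi hdw).trans
        (innerDirectionalNormalCone_subset _ _ _))
  · intro hx hy
    obtain ⟨hb, c, hc, rfl⟩ := exists_eq_smul_hat hxy hx.2 hy.2
    refine ⟨?_, ?_, fun d w hdw => ?_⟩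
    · ext q
      rw [hb.mem_bouligandTangentCone_pair hc]
      exact hb.tangent_formula_iff hc
    · ext p
      refine Iff.trans ⟨hb.limitingNormalCone_pair_subset hc, ?_⟩ (hb.normal_formula_iff hc)
      rintro ⟨h1, r, h2⟩
      exact hb.mem_limitingNormalCone_pair hc.le h1 h2
    · exact (directionalNormalCone_subset_limiting _ _ _).antisymm
        ((hb.limitingNormalCone_pair_subset_inner hc hdw).trans
          (innerDirectionalNormalCone_subset _ _ _))
  · rintro hx rfl
    have hb := isBoundary_of_mem_frontier hx
    refine ⟨?_, hb.limitingNormalCone_pair_zero_eq, fun d w _ => ⟨?_, ?_, ?_⟩⟩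
    · ext q
      rw [hb.mem_bouligandTangentCone_pair_zero, hb.bouligandTangentCone_eq]
      rfl
    · rintro hd rfl
      exact (hb.inner_of_pos (hb.inner_pos_of_mem_interior hd)).1
    · rintro hd rfl
      exact (directionalNormalCone_subset_limiting _ _ _).antisymm
        ((hb.limiting_subset_inner_of_perp (hb.inner_eq_zero_of_mem_frontier hd)).trans
          (innerDirectionalNormalCone_subset _ _ _))
    · rintro hd ⟨s, hs, rfl⟩ hw
      exact (hb.directional_of_perp_pos hd (hs.lt_of_ne' fun h => hw (by rw [h, zero_smul]))).1
  · rintro rfl hy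
    have hb := isBoundary_of_mem_frontier hy
    have hN : limitingNormalCone (socComplementaritySet m) (socPair 0 y) =
        {p | p.snd = 0 ∨ (inner ℝ p.fst y.hat = 0 ∧ ∃ s : ℝ, p.snd = s • y.hat) ∨
          (inner ℝ p.fst y.hat ≤ 0 ∧ ∃ s : ℝ, s ≤ 0 ∧ p.snd = s • y.hat)} := by
      ext p
      rw [← swap_mem_limitingNormalCone_iff]
      refine (Set.ext_iff.1 hb.limitingNormalCone_pair_zero_eq (socSwap m p)).trans ?_
      exact or_congr Iff.rfl (or_congr and_comm and_comm)
    -- Transfers the directional formulas from `(y, 0)` to `(0, y)`.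
    have hD : ∀ {d w : SOCSpace m} {p}, p ∈ directionalNormalCone (socComplementaritySet m)
        (socPair 0 y) (socPair d w) ↔ socSwap m p ∈ directionalNormalCone
        (socComplementaritySet m) (socPair y 0) (socPair w d) := fun {d w p} =>
      (swap_mem_directionalNormalCone_iff (z := socPair 0 y) (δ := socPair d w)).symm
    refine ⟨?_, hN, fun d w _ => ⟨?_, ?_, ?_⟩⟩
    · ext q
      rw [← swap_mem_bouligandTangentCone_iff, hb.bouligandTangentCone_eq]
      refine hb.mem_bouligandTangentCone_pair_zero.trans ?_
      exact or_congr and_comm and_comm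
    · rintro rfl hw
      ext p
      rw [hD, (hb.inner_of_pos (hb.inner_pos_of_mem_interior hw)).1]
      rfl
    · rintro rfl hw
      refine (directionalNormalCone_subset_limiting _ _ _).antisymm fun p hp => ?_
      rw [← swap_mem_limitingNormalCone_iff] at hp
      exact hD.2 (innerDirectionalNormalCone_subset _ _ _
        (hb.limiting_subset_inner_of_perp (hb.inner_eq_zero_of_mem_frontier hw) hp))
    · rintro ⟨s, hs, rfl⟩ hd hw
      ext p
      rw [hD, (hb.directional_of_perp_pos hw
        (hs.lt_of_ne' fun h => hd (by rw [h, zero_smul]))).1]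
      exact and_comm
  · rintro rfl rfl
    refine ⟨bouligandTangentCone_zero, limitingNormalCone_zero_eq, fun d w _ => ?_⟩
    exact (directionalNormalCone_zero_of_cone smul_mem_socComplementaritySet _).antisymm
      ((limitingNormalCone_subset_innerDirectional_zero_of_cone
        smul_mem_socComplementaritySet _).trans (innerDirectionalNormalCone_subset _ _ _))
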